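/- **Notation.** Let $\alpha_1,\alpha_2,\dots;\beta_1,\beta_2,\dots$ be variables, and put $x_i=1-1/\alpha_i$, $y_j=1-\beta_j$. *Double Grothendieck functions.* For a permutation $w\in S_n$ let $\ell(w)$ be its number of inversions and let $s_i$ be the transposition $(i\ i{+}1)$. The rational function $\mathfrak G_w(\alpha;\beta)$ is defined recursively by $$\mathfrak G_{w_0}=\prod_{i+j\le n}\Bigl(1-\frac{\beta_i}{\alpha_j}\Bigr)\quad\text{for } w_0=[n,n-1,\dots,1],\qquad \mathfrak G_w=\pi_i(\mathfrak G_{ws_i})\ \text{ if }\ell(ws_i)=\ell(w)+1,$$ where $\pi_i(f)=\dfrac{\alpha_i f-\alpha_{i+1}\,s_i f}{\alpha_i-\alpha_{i+1}}$ and $s_if$ is $f$ with $\alpha_i$ and $\alpha_{i+1}$ exchanged. *Stable limit.* For $w\in S_n$ let $1^m\times w\in S_{m+n}$ be the permutation that fixes $1,\dots,m$ and maps $j\mapsto w(j-m)+m$ for $j>m$. Rewrite $\mathfrak G_{1^m\times w}$ as a polynomial in the $x_i,y_j$. Then $G_w\in\mathbb Z[[x_1,x_2,\dots;y_1,y_2,\dots]]$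 is the power series each of whose coefficients is the corresponding coefficient of $\mathfrak G_{1^m\times w}$ for all sufficiently large $m$. *Partitions.* For a partition $\lambda$ (a finite weakly decreasing sequence of nonnegative integers, continued by zeros) put $G_\lambda=G_{w_\lambda}$, where, for any $p$ with $\lambda_i=0$ for all $i>p$, $w_\lambda$ is the permutation with $w_\lambda(i)=i+\lambda_{p+1-i}$ for $i\le p$ and $w_\lambda(i)<w_\lambda(i+1)$ unless $i=p$. *Integer sequences.* For a finite integer sequence $I$, $G_I\in\mathbb Z[[x;y]]$ is obtained from the $G_\lambda$ by repeated applications of the straightening laws $$G_{I,p,q,J}=\sum_{k=p+1}^{q}G_{I,q,k,J}-\sum_{k=p+1}^{q-1}G_{I,q-1,k,J}\quad (p<q),\qquad G_{I,p}=G_{I,0}=G_I\quad (p<0).$$ *Truncation.* For nonnegative integers $k,l$, $G_I(\alpha_1,\dots,\alpha_k;\beta_1,\dots,\beta_l)$ is the specialization of $G_I$ at $\alpha_i=1$ for $i>k$ and $\beta_j=1$ for $j>l$ (that is, $x_i=0$ for $i>k$, $y_j=0$ for $j>l$). *Residues.* Write $\operatorname{Res}_{z=0,\infty}f(z)\,dz=\operatorname{Res}_{z=0}f(z)\,dz+\operatorname{Res}_{z=\infty}f(z)\,dz$.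 For $I=(I_1,\dots,I_r)\in\mathbb Z^r$, complex $\alpha_1,\dots,\alpha_k\neq0$ and complex $\beta_1,\dots,\beta_l$, let $$g_I(\alpha_1,\dots,\alpha_k;\beta_1,\dots,\beta_l)=\operatorname{Res}_{z_1=0,\infty}\cdots\operatorname{Res}_{z_r=0,\infty}\left(\prod_{j=1}^r(1-z_j)^{I_j-j}\prod_{i>j}\Bigl(1-\frac{z_i}{z_j}\Bigr)\prod_{j=1}^r\frac{\prod_{i=1}^l(1-z_j\beta_i)}{\prod_{i=1}^k(1-z_j\alpha_i)\,(1-z_j)^{l-k}}\prod_{j=1}^r\frac{dz_j}{z_j}\right).$$ **Theorem.** For every finite integer sequence $I$ the power series $G_I$ is well defined: the straightening laws and stable limits produce a value for $G_I$, and it does not depend on any of the choices made. For all nonnegative integers $k,l$, the truncation $G_I(\alpha_1,\dots,\alpha_k;\beta_1,\dots,\beta_l)$ is a polynomial in $x_1,\dots,x_k,y_1,\dots,y_l$ with integer coefficients, and for all nonzero complex $\alpha_1,\dots,\alpha_k$ and all complex $\beta_1,\dots,\beta_l$ its value is $$G_I(\alpha_1,\dots,\alpha_k;\beta_1,\dots,\beta_l)=g_I(\alpha_1,\dots,\alpha_k;\beta_1,\dots,\beta_l).$$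 -/

import Mathlib

open Filter Topology

noncomputable section

namespace StableGrothendieck

/-! ### Double Grothendieck functions of permutations

Variables are numbered from `0`: `Sum.inl i` is the variable written `α_{i+1}` in one-based
notation, `Sum.inr j` is `β_{j+1}`. Likewise a permutation of `{1, …, n}` is an element of
`Equiv.Perm (Fin n)`. -/

/-- The field `ℚ(α_1, α_2, …; β_1, β_2, …)` of rational functions in the `α`'s and `β`'s. -/
abbrev RatField : Type := FractionRing (MvPolynomial (ℕ ⊕ ℕ) ℤ)

/-- The variable `α_{i+1}`. -/
def alpha (i : ℕ) : RatField :=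
  algebraMap (MvPolynomial (ℕ ⊕ ℕ) ℤ) RatField (MvPolynomial.X (Sum.inl i))

/-- The variable `β_{j+1}`. -/
def beta (j : ℕ) : RatField :=
  algebraMap (MvPolynomial (ℕ ⊕ ℕ) ℤ) RatField (MvPolynomial.X (Sum.inr j))

/-- The automorphism of the field of rational functions that exchanges `α_{i+1}` and `α_{i+2}`
and fixes all other variables. -/
def swapAlpha (i : ℕ) : RatField ≃+* RatField :=
  IsFractionRing.ringEquivOfRingEquiv
    (MvPolynomial.renameEquiv ℤ
      (Equiv.sumCongr (Equiv.swap i (i + 1)) (Equiv.refl ℕ))).toRingEquiv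

/-- The isobaric divided difference operator in the variables `α_{i+1}`, `α_{i+2}`. -/
def isobaric (i : ℕ) (f : RatField) : RatField :=
  (alpha i * f - alpha (i + 1) * swapAlpha i f) / (alpha i - alpha (i + 1))

/-- The length of a permutation: its number of inversions. -/
def invCount {n : ℕ} (w : Equiv.Perm (Fin n)) : ℕ :=
  (Finset.univ.filter fun q : Fin n × Fin n => q.1 < q.2 ∧ w q.2 < w q.1).card

/-- The product of `1 - β_i / α_j` over the (one-based) `i, j ≥ 1` with `i + j ≤ n`. -/
def longestValue (n : ℕ) : RatField :=
  ∏ q ∈ (Finset.range n ×ˢ Finset.range n).filter (fun q => q.1 + q.2 + 2 ≤ n),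
    (1 - beta q.1 / alpha q.2)

/-- `IsGrothendieck w f` says that the recursion for double Grothendieck functions produces `f`
as the value at `w`: it starts from the longest permutation, and passes from `w s_i` to `w` by
the isobaric divided difference whenever `w s_i` is longer than `w`. -/
inductive IsGrothendieck {n : ℕ} : Equiv.Perm (Fin n) → RatField → Prop
  | longest : IsGrothendieck Fin.revPerm (longestValue n)
  | step (w : Equiv.Perm (Fin n)) (i : ℕ) (hi : i + 1 < n) (f : RatField)
      (hlen : invCount (w * Equiv.swap ⟨i, Nat.lt_of_succ_lt hi⟩ ⟨i + 1, hi⟩) = invCount w + 1)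
      (hf : IsGrothendieck (w * Equiv.swap ⟨i, Nat.lt_of_succ_lt hi⟩ ⟨i + 1, hi⟩) f) :
      IsGrothendieck w (isobaric i f)

/-! ### Stable limits

The variables of the polynomials and power series below are `x_i = 1 - 1 / α_i` (at `Sum.inl`)
and `y_j = 1 - β_j` (at `Sum.inr`). -/

/-- `P`, a polynomial in the `x`'s and `y`'s, is the function `f` of the `α`'s and `β`'s
rewritten by `x_i = 1 - 1 / α_i`, `y_j = 1 - β_j`. -/
def IsRewrittenAs (f : RatField) (P : MvPolynomial (ℕ ⊕ ℕ) ℤ) : Prop :=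
  MvPolynomial.aeval (Sum.elim (fun i => 1 - (alpha i)⁻¹) (fun j => 1 - beta j)) P = f

/-- The permutation `1^m × w`, the identity on the first `m` letters, and `w` on the others. -/
def shiftPerm (m : ℕ) {n : ℕ} (w : Equiv.Perm (Fin n)) : Equiv.Perm (Fin (m + n)) :=
  finSumFinEquiv.permCongr (Equiv.sumCongr (Equiv.refl (Fin m)) w)

/-- `G` is the stable limit of the double Grothendieck functions of `1^m × w` as `m → ∞`: each
coefficient in the variables `x_i`, `y_j` is eventually that of `G`. -/
def IsStableLimit {n : ℕ} (w : Equiv.Perm (Fin n)) (G : MvPowerSeries (ℕ ⊕ ℕ) ℤ) : Prop :=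
  ∀ d : (ℕ ⊕ ℕ) →₀ ℕ, ∀ᶠ m in atTop, ∃ (f : RatField) (P : MvPolynomial (ℕ ⊕ ℕ) ℤ),
    IsGrothendieck (shiftPerm m w) f ∧ IsRewrittenAs f P ∧
      MvPolynomial.coeff d P = MvPowerSeries.coeff d G

/-! ### Partitions and integer sequences -/

/-- A partition: a weakly decreasing finite sequence of nonnegative integers. -/
def IsPartition (lam : List ℤ) : Prop :=
  lam.Pairwise (fun a b => b ≤ a) ∧ ∀ a ∈ lam, 0 ≤ a

/-- `w` is the Grassmannian permutation of the partition `lam` with descent in position `p`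
(where `p` is at least the length of `lam`). In one-based notation,
`w(i) = i + lam_{p+1-i}` for `i ≤ p`, and `w(i) < w(i+1)` unless `i = p`. -/
structure IsGrassmannian (lam : List ℤ) (p : ℕ) {n : ℕ} (w : Equiv.Perm (Fin n)) : Prop where
  p_le : p ≤ n
  length_le : ∀ j : ℕ, p ≤ j → lam.getD j 0 = 0
  apply_lt : ∀ i : Fin n, (i : ℕ) < p → ((w i : ℕ) : ℤ) = (i : ℕ) + lam.getD (p - 1 - i) 0
  increasing : ∀ (i : ℕ) (hi : i + 1 < n), i + 1 ≠ p →
    w ⟨i, Nat.lt_of_succ_lt hi⟩ < w ⟨i + 1, hi⟩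

/-- `IsDoubleStable I G` says that the power series `G` in the `x_i`, `y_j` is a value of the
double stable Grothendieck polynomial of the integer sequence `I`: for a partition it is the
stable limit for a Grassmannian permutation of the partition, and otherwise it is obtained by
repeated applications of the straightening laws
`G_{I,p,q,J} = ∑_{k=p+1}^{q} G_{I,q,k,J} - ∑_{k=p+1}^{q-1} G_{I,q-1,k,J}` for `p < q`, and
`G_{I,p} = G_{I,0} = G_I` for `p < 0`. -/
inductive IsDoubleStable : List ℤ → MvPowerSeries (ℕ ⊕ ℕ) ℤ → Prop
  | partition (lam : List ℤ) (hlam : IsPartition lam) (p n : ℕ) (w : Equiv.Perm (Fin n))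
      (hw : IsGrassmannian lam p w) (G : MvPowerSeries (ℕ ⊕ ℕ) ℤ) (hG : IsStableLimit w G) :
      IsDoubleStable lam G
  | exchange (I J : List ℤ) (p q : ℤ) (hpq : p < q) (A B : ℤ → MvPowerSeries (ℕ ⊕ ℕ) ℤ)
      (hA : ∀ k ∈ Finset.Icc (p + 1) q, IsDoubleStable (I ++ [q, k] ++ J) (A k))
      (hB : ∀ k ∈ Finset.Icc (p + 1) (q - 1), IsDoubleStable (I ++ [q - 1, k] ++ J) (B k)) :
      IsDoubleStable (I ++ [p, q] ++ J)
        (∑ k ∈ Finset.Icc (p + 1) q, A k - ∑ k ∈ Finset.Icc (p + 1) (q - 1), B k)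
  | negative (I : List ℤ) (p : ℤ) (hp : p < 0) (G : MvPowerSeries (ℕ ⊕ ℕ) ℤ)
      (hG : IsDoubleStable (I ++ [0]) G) : IsDoubleStable (I ++ [p]) G
  | zero (I : List ℤ) (G : MvPowerSeries (ℕ ⊕ ℕ) ℤ)
      (hG : IsDoubleStable I G) : IsDoubleStable (I ++ [0]) G

/-- The specialization `α_i = 1` for `i > k` and `β_j = 1` for `j > l`, which is `x_i = 0` for
`i > k` and `y_j = 0` for `j > l`: only the monomials in the first `k` of the `x`'s and the
first `l` of the `y`'s survive. -/
def truncate (k l : ℕ) (G : MvPowerSeries (ℕ ⊕ ℕ) ℤ) : MvPowerSeries (Fin k ⊕ Fin l) ℤ :=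
  fun d => MvPowerSeries.coeff
    (d.mapDomain (Sum.map (Fin.val : Fin k → ℕ) (Fin.val : Fin l → ℕ))) G

/-! ### Iterated residues -/

/-- The residue at `z = 0` of `f(z) dz`: the normalized integral over small circles. -/
def resZero (f : ℂ → ℂ) : ℂ :=
  limUnder (𝓝[>] (0 : ℝ)) fun ε : ℝ =>
    (2 * (Real.pi : ℂ) * Complex.I)⁻¹ * ∮ z in C(0, ε), f z

/-- The residue at `z = ∞` of `f(z) dz`: minus the normalized integral over large circles. -/
def resInfty (f : ℂ → ℂ) : ℂ :=
  -limUnder (atTop : Filter ℝ) fun R : ℝ =>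
    (2 * (Real.pi : ℂ) * Complex.I)⁻¹ * ∮ z in C(0, R), f z

/-- The sum of the residues of `f(z) dz` at `0` and at `∞`. -/
def resZeroInfty (f : ℂ → ℂ) : ℂ := resZero f + resInfty f

/-- The iterated residue `Res_{z_1 = 0, ∞} … Res_{z_r = 0, ∞} F(z_1, …, z_r) dz_1 ⋯ dz_r`,
with the residue in `z_r` taken first. -/
def iteratedRes : (r : ℕ) → ((Fin r → ℂ) → ℂ) → ℂ
  | 0, F => F Fin.elim0
  | r + 1, F => resZeroInfty fun z => iteratedRes r fun v => F (Fin.cons z v)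

/-- The coefficient of `dz_1 ⋯ dz_r` in the form `M_{k,l}(z_1, …, z_r)`. -/
def formM {r k l : ℕ} (α : Fin k → ℂ) (β : Fin l → ℂ) (z : Fin r → ℂ) : ℂ :=
  (∏ j, (∏ i, (1 - z j * β i)) /
    ((∏ i, (1 - z j * α i)) * (1 - z j) ^ ((l : ℤ) - (k : ℤ)))) * ∏ j, (z j)⁻¹

/-- The function `g_I(α_1, …, α_k; β_1, …, β_l)` defined by the iterated residue. The
exponent `I_j - j` refers to the one-based index `j`. -/
def gRes (I : List ℤ) {k l : ℕ} (α : Fin k → ℂ) (β : Fin l → ℂ) : ℂ :=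
  iteratedRes I.length fun z =>
    (∏ j, (1 - z j) ^ (I.get j - ((j : ℕ) + 1 : ℤ))) *
      (∏ j, ∏ i ∈ Finset.Ioi j, (1 - z i / z j)) * formM α β z

end StableGrothendieck

end

/-! Both sides are values of one determinant. Let `c(a, b)` be the sum of the residues at `0` and
`∞` of `z^b (1 - z)^(a + k - l) ∏ (1 - β_q z) / ∏ (1 - α_s z) dz / z` (`resCoeff`). The product of
the `1 - z_i / z_j` is a Vandermonde determinant in the `1 / z_j`; expanding it separates the
variables and turns `g_I` into `det c(I_j - j, j - i)` (`gRes_eq_resDet`).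

This determinant obeys the rules imposed on `G_I`. From `c(a, b + 1) = c(a, b) - c(a + 1, b)`
neighbouring columns are related, and the exchange law follows by telescoping and antisymmetry
(`shiftDet_exchange`). A last entry `≤ 0` makes the last column a unit vector (`shiftDet_succ`). A
unitriangular Toeplitz factor shows that the determinant is an integral polynomial in the `1 / α_s`
and `β_q` (`aeval_resPoly`). Parameters equal to `1` do not change `c`, so these polynomials fit
together to one power series, `resSeries`.

It remains to treat partitions. Antisymmetrization against the staircase monomial does not see the
operators `π_i` (`antisymmetrize_isobaric`). A Grassmannian permutation may therefore be replaced by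
the one with its first `p` values reversed, which is dominant, so that its Grothendieck function is
a product (`IsGrothendieck.of_antitone_code`). This gives a quotient of determinants
(`IsGrothendieck.det_mul_eq`), which partial fractions convert into the residue determinant
(`det_resSum_eq`). Column `j` then involves exactly `λ_j + p - j` of the `β`'s, the number for which
the power of `1 - z` disappears. For `1^m × w` these numbers grow with `m`, so each coefficient
becomes that of `resSeries`.

For well-definedness, the recursion for permutations has one outcome because the `π_i` satisfy the
braid relations (`IsGrothendieck.unique`); every derivation by the straightening laws ends in the
same series (`IsDoubleStable.eq_listSeries`); and a derivation exists because straightening moves up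
lexicographically in a finite box (`IsDoubleStable.exists_of_bounds`). -/

noncomputable section

namespace StableGrothendieck

/-! ### Formal expansions at `0` and `∞` -/

section Series

variable {R S : Type*} [CommRing R] [CommRing S]

/-- The coefficient of a power series at an integer, zero at the negative ones. -/
def intCoeff (p : PowerSeries R) (m : ℤ) : R :=
  if 0 ≤ m then PowerSeries.coeff m.toNat p else 0

theorem intCoeff_of_neg (p : PowerSeries R) {m : ℤ} (hm : m < 0) : intCoeff p m = 0 :=
  if_neg (by omega)

@[simp] theorem intCoeff_natCast (p : PowerSeries R) (m : ℕ) :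
    intCoeff p m = PowerSeries.coeff m p := by
  simp [intCoeff]

theorem intCoeff_zero (p : PowerSeries R) : intCoeff p 0 = PowerSeries.constantCoeff p := by
  simp [intCoeff]

theorem intCoeff_sub (p q : PowerSeries R) (m : ℤ) :
    intCoeff (p - q) m = intCoeff p m - intCoeff q m := by
  unfold intCoeff; split_ifs <;> simp

theorem intCoeff_C_mul (p : PowerSeries R) (c : R) (m : ℤ) :
    intCoeff (PowerSeries.C c * p) m = c * intCoeff p m := by
  unfold intCoeff; split_ifs <;> simp

theorem intCoeff_X_mul (p : PowerSeries R) (m : ℤ) :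
    intCoeff (PowerSeries.X * p) m = intCoeff p (m - 1) := by
  rcases lt_trichotomy m 0 with h | rfl | h
  · rw [intCoeff_of_neg _ h, intCoeff_of_neg _ (by omega)]
  · rw [intCoeff_of_neg _ (by omega : (0 : ℤ) - 1 < 0), intCoeff_zero]; simp
  · obtain ⟨n, rfl⟩ : ∃ n : ℕ, m = n + 1 := ⟨(m - 1).toNat, by omega⟩
    rw [add_sub_cancel_right, intCoeff_natCast, ← Nat.cast_succ, intCoeff_natCast,
      PowerSeries.coeff_succ_X_mul]

theorem intCoeff_map (f : R →+* S) (p : PowerSeries R) (m : ℤ) :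
    intCoeff (PowerSeries.map f p) m = f (intCoeff p m) := by
  unfold intCoeff; split_ifs <;> simp

theorem intCoeff_mul (E p : PowerSeries R) (m : ℤ) (M : ℕ) (hM : m < M) :
    intCoeff (E * p) m =
      ∑ u ∈ Finset.range M, PowerSeries.coeff u E * intCoeff p (m - u) := by
  rcases lt_or_ge m 0 with h | h
  · rw [intCoeff_of_neg _ h]
    exact (Finset.sum_eq_zero fun u _ => by rw [intCoeff_of_neg _ (by omega), mul_zero]).symm
  · lift m to ℕ using h
    rw [intCoeff_natCast, PowerSeries.coeff_mul,
      Finset.Nat.sum_antidiagonal_eq_sum_range_succ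
        (fun i j => PowerSeries.coeff i E * PowerSeries.coeff j p)]
    have hsub : Finset.range (m + 1) ⊆ Finset.range M := by
      intro u; simp only [Finset.mem_range]; omega
    rw [← Finset.sum_subset hsub]
    · refine Finset.sum_congr rfl fun u hu => ?_
      rw [Finset.mem_range] at hu
      rw [← intCoeff_natCast p, Nat.cast_sub (by omega)]
    · intro u _ hu
      rw [Finset.mem_range] at hu
      rw [intCoeff_of_neg _ (by omega), mul_zero]

/-- The geometric series `∑ aⁿ Xⁿ`. -/
def geomSeries (a : R) : PowerSeries R := PowerSeries.mk fun n => a ^ n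

theorem one_sub_mul_geomSeries (a : R) :
    (1 - PowerSeries.C a * PowerSeries.X) * geomSeries a = 1 := by
  ext n
  rw [sub_mul, one_mul, mul_assoc, map_sub, PowerSeries.coeff_C_mul]
  cases n with
  | zero => simp [geomSeries]
  | succ n =>
    rw [PowerSeries.coeff_succ_X_mul]
    simp [geomSeries, PowerSeries.coeff_one, pow_succ']

theorem map_geomSeries (f : R →+* S) (a : R) :
    PowerSeries.map f (geomSeries a) = geomSeries (f a) := by
  ext n; simp [geomSeries]

/-- The unit `1 - X` of the ring of power series. -/
def oneSubX : (PowerSeries R)ˣ where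
  val := 1 - PowerSeries.X
  inv := geomSeries 1
  val_inv := by simpa using one_sub_mul_geomSeries (1 : R)
  inv_val := by rw [mul_comm]; simpa using one_sub_mul_geomSeries (1 : R)

/-- The power series `(1 - X)ⁿ`, for an integer `n`. -/
def oneSubPow (n : ℤ) : PowerSeries R := ((oneSubX ^ n : (PowerSeries R)ˣ) : PowerSeries R)

theorem oneSubPow_add_one (n : ℤ) :
    (oneSubPow (n + 1) : PowerSeries R) = (1 - PowerSeries.X) * oneSubPow n := by
  rw [oneSubPow, zpow_add_one, mul_comm]; rfl

@[simp] theorem oneSubPow_zero : (oneSubPow 0 : PowerSeries R) = 1 := by simp [oneSubPow]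

theorem oneSubPow_add_one_mul_geomSeries_one (n : ℤ) :
    (oneSubPow (n + 1) * geomSeries 1 : PowerSeries R) = oneSubPow n := by
  rw [oneSubPow_add_one, mul_assoc, mul_comm, mul_assoc, mul_comm (geomSeries 1)]
  have h := one_sub_mul_geomSeries (1 : R)
  rw [map_one, one_mul] at h
  rw [h, mul_one]

theorem map_oneSubPow (f : R →+* S) (n : ℤ) :
    PowerSeries.map f (oneSubPow n) = oneSubPow n := by
  have h : Units.map (PowerSeries.map f : PowerSeries R →* PowerSeries S) oneSubX = oneSubX := by
    ext1; simp [oneSubX]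
  rw [oneSubPow, oneSubPow, ← h, ← map_zpow]; rfl

theorem constantCoeff_oneSubPow (n : ℤ) :
    PowerSeries.constantCoeff (oneSubPow n : PowerSeries R) = 1 := by
  have h : Units.map ((PowerSeries.constantCoeff (R := R) : PowerSeries R →+* R) :
      PowerSeries R →* R) oneSubX = 1 := by
    ext1; simp [oneSubX]
  have h2 := congrArg Units.val (map_zpow (Units.map
    ((PowerSeries.constantCoeff (R := R) : PowerSeries R →+* R) : PowerSeries R →* R)) oneSubX n)
  rw [h, one_zpow] at h2
  exact h2

theorem constantCoeff_geomSeries (a : R) :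
    PowerSeries.constantCoeff (geomSeries a) = 1 := by
  rw [← PowerSeries.coeff_zero_eq_constantCoeff_apply]; simp [geomSeries]

/-- The numerator `(1 - z)ⁿ ∏ (1 - β_q z)`, with `l` factors, expanded at `z = 0`. -/
def numerZero (l : ℕ) (n : ℤ) (β : ℕ → R) : PowerSeries R :=
  oneSubPow n * ∏ q ∈ Finset.range l, (1 - PowerSeries.C (β q) * PowerSeries.X)

/-- The expansion at `z = 0` of `(1 - z)ⁿ ∏ (1 - β_q z) / ∏ (1 - α_s z)`, with `l` factors in
the numerator and `k` factors in the denominator. -/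
def seriesZero (k l : ℕ) (n : ℤ) (α β : ℕ → R) : PowerSeries R :=
  numerZero l n β * ∏ s ∈ Finset.range k, geomSeries (α s)

/-- The expansion in `w = 1 / z`, up to sign, a power of `w` and the factor `∏ a_s`, of
`(1 - z)ⁿ ∏ (1 - β_q z) / ∏ (1 - z / a_s)`. -/
def seriesInfty (k l : ℕ) (n : ℤ) (a β : ℕ → R) : PowerSeries R :=
  oneSubPow n * (∏ q ∈ Finset.range l, (PowerSeries.X - PowerSeries.C (β q))) *
    ∏ s ∈ Finset.range k, geomSeries (a s)

theorem map_numerZero (f : R →+* S) (l : ℕ) (n : ℤ) (β : ℕ → R) :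
    PowerSeries.map f (numerZero l n β) = numerZero l n (fun q => f (β q)) := by
  simp [numerZero, map_oneSubPow, map_prod]

theorem map_seriesInfty (f : R →+* S) (k l : ℕ) (n : ℤ) (a β : ℕ → R) :
    PowerSeries.map f (seriesInfty k l n a β) =
      seriesInfty k l n (fun s => f (a s)) (fun q => f (β q)) := by
  simp [seriesInfty, map_oneSubPow, map_prod, map_geomSeries]

end Series

/-! ### Residue sums in one variable and their recurrences -/

section Field

variable {K : Type*} [Field K]

/-- The sum of the residues at `0` and `∞` of
`z^b (1 - z)ⁿ ∏ (1 - β_q z) / ∏ (1 - α_s z) dz / z`, with `l` factors in the numerator and `k`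
factors in the denominator, in terms of the expansions at these two points. -/
def resSum (k l : ℕ) (n b : ℤ) (α β : ℕ → K) : K :=
  intCoeff (seriesZero k l n α β) (-b) -
    (-1) ^ (n + k) * (∏ s ∈ Finset.range k, (α s)⁻¹) *
      intCoeff (seriesInfty k l n (fun s => (α s)⁻¹) β) (n - k + l + b)

/-- Expanding `1 - β_l z` splits the form in two, and the factor `z` raises `b`. At `∞` the factor
reads `X - β_l`, so there the shift by `X` falls on the other term; the summand `l` in the index `n
- k + l + b` compensates for this. -/
theorem resSum_numer_succ (k l : ℕ) (n b : ℤ) (α β : ℕ → K) :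
    resSum k (l + 1) n b α β = resSum k l n b α β - β l * resSum k l n (b + 1) α β := by
  have h0 : seriesZero k (l + 1) n α β =
      seriesZero k l n α β - PowerSeries.C (β l) * (PowerSeries.X * seriesZero k l n α β) := by
    rw [seriesZero, seriesZero, numerZero, numerZero, Finset.prod_range_succ]; ring
  have h1 : seriesInfty k (l + 1) n (fun s => (α s)⁻¹) β =
      PowerSeries.X * seriesInfty k l n (fun s => (α s)⁻¹) β -
        PowerSeries.C (β l) * seriesInfty k l n (fun s => (α s)⁻¹) β := by
    rw [seriesInfty, seriesInfty, Finset.prod_range_succ]; ring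
  rw [resSum, resSum, resSum, h0, h1, intCoeff_sub, intCoeff_sub, intCoeff_C_mul, intCoeff_C_mul,
    intCoeff_X_mul, intCoeff_X_mul, show -b - 1 = -(b + 1) by ring,
    show n - k + ((l + 1 : ℕ) : ℤ) + b - 1 = n - k + l + b by push_cast; ring,
    show n - k + ((l + 1 : ℕ) : ℤ) + b = n - k + l + (b + 1) by push_cast; ring]
  ring

theorem resSum_exponent_succ (k l : ℕ) (n b : ℤ) (α β : ℕ → K) :
    resSum k l (n + 1) b α β = resSum k l n b α β - resSum k l n (b + 1) α β := by
  have h0 : seriesZero k l (n + 1) α β =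
      seriesZero k l n α β - PowerSeries.X * seriesZero k l n α β := by
    rw [seriesZero, seriesZero, numerZero, numerZero, oneSubPow_add_one]; ring
  have h1 : seriesInfty k l (n + 1) (fun s => (α s)⁻¹) β =
      seriesInfty k l n (fun s => (α s)⁻¹) β -
        PowerSeries.X * seriesInfty k l n (fun s => (α s)⁻¹) β := by
    rw [seriesInfty, seriesInfty, oneSubPow_add_one]; ring
  rw [resSum, resSum, resSum, h0, h1, intCoeff_sub, intCoeff_sub,
    intCoeff_X_mul, intCoeff_X_mul, show -b - 1 = -(b + 1) by ring,
    show n + 1 - k + l + b - 1 = n - k + l + b by ring,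
    show n + 1 - k + l + b = n - k + l + (b + 1) by ring,
    show n + 1 + (k : ℤ) = n + k + 1 by ring, zpow_add_one₀ (by norm_num)]
  ring

theorem resSum_denom_succ (k l : ℕ) (n b : ℤ) (α β : ℕ → K) (hα : α k ≠ 0) :
    resSum (k + 1) l n b α β - α k * resSum (k + 1) l n (b + 1) α β = resSum k l n b α β := by
  have h0 : seriesZero k l n α β = seriesZero (k + 1) l n α β -
      PowerSeries.C (α k) * (PowerSeries.X * seriesZero (k + 1) l n α β) := by
    rw [seriesZero, seriesZero, Finset.prod_range_succ]
    linear_combination (-numerZero l n β * ∏ s ∈ Finset.range k, geomSeries (α s)) *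
      one_sub_mul_geomSeries (α k)
  have h1 : seriesInfty k l n (fun s => (α s)⁻¹) β =
      seriesInfty (k + 1) l n (fun s => (α s)⁻¹) β -
      PowerSeries.C (α k)⁻¹ * (PowerSeries.X * seriesInfty (k + 1) l n (fun s => (α s)⁻¹) β) := by
    rw [seriesInfty, seriesInfty, Finset.prod_range_succ _ k]
    linear_combination (-(oneSubPow n * (∏ q ∈ Finset.range l, (PowerSeries.X - PowerSeries.C (β q))) *
      ∏ s ∈ Finset.range k, geomSeries (α s)⁻¹)) * one_sub_mul_geomSeries (α k)⁻¹
  rw [resSum, resSum, resSum, h0, h1, intCoeff_sub, intCoeff_sub, intCoeff_C_mul, intCoeff_C_mul,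
    intCoeff_X_mul, intCoeff_X_mul, Finset.prod_range_succ, show -b - 1 = -(b + 1) by ring,
    show n - ((k + 1 : ℕ) : ℤ) + l + b = n - k + l + b - 1 by push_cast; ring,
    show n - ((k + 1 : ℕ) : ℤ) + l + (b + 1) = n - k + l + b by push_cast; ring,
    show n + ((k + 1 : ℕ) : ℤ) = n + k + 1 by push_cast; ring, zpow_add_one₀ (by norm_num)]
  field_simp
  ring

/-- A parameter `α_k = 1` contributes `(1 - z)⁻¹`, which cancels the additional factor `1 - z`. -/
theorem resSum_denom_one (k l : ℕ) (n b : ℤ) (α β : ℕ → K) (hα : α k = 1) :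
    resSum (k + 1) l (n + 1) b α β = resSum k l n b α β := by
  have h0 : seriesZero (k + 1) l (n + 1) α β = seriesZero k l n α β := by
    rw [seriesZero, seriesZero, Finset.prod_range_succ, hα, numerZero, numerZero,
      ← oneSubPow_add_one_mul_geomSeries_one n]; ring
  have h1 : seriesInfty (k + 1) l (n + 1) (fun s => (α s)⁻¹) β =
      seriesInfty k l n (fun s => (α s)⁻¹) β := by
    rw [seriesInfty, seriesInfty, Finset.prod_range_succ _ k, hα, inv_one,
      ← oneSubPow_add_one_mul_geomSeries_one n]; ring
  rw [resSum, resSum, h0, h1, Finset.prod_range_succ, hα, inv_one, mul_one,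
    show n + 1 - ((k + 1 : ℕ) : ℤ) + l + b = n - k + l + b by push_cast; ring,
    show n + 1 + ((k + 1 : ℕ) : ℤ) = n + k + 1 + 1 by push_cast; ring,
    zpow_add_one₀ (by norm_num), zpow_add_one₀ (by norm_num)]
  ring

theorem resSum_numer_one (k l : ℕ) (n b : ℤ) (α β : ℕ → K) (hβ : β l = 1) :
    resSum k (l + 1) n b α β = resSum k l (n + 1) b α β := by
  rw [resSum_numer_succ, resSum_exponent_succ, hβ, one_mul]

/-- Under these bounds the form has no residue at `∞`, and at `0` the integrand is `z^b` times a
series with constant term `1`, divided by `z`. -/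
theorem resSum_of_neg (k l : ℕ) (n b : ℤ) (α β : ℕ → K) (hb : 0 ≤ b) (h : n - k + l + b < 0) :
    resSum k l n b α β = if b = 0 then 1 else 0 := by
  rw [resSum, intCoeff_of_neg _ h, mul_zero, sub_zero]
  split_ifs with hb0
  · subst hb0
    rw [neg_zero, intCoeff_zero]
    simp [seriesZero, numerZero, constantCoeff_oneSubPow, constantCoeff_geomSeries, map_prod]
  · exact intCoeff_of_neg _ (by omega)

/-- `resSum` with the exponent of `1 - z` normalized so that it does not change when parameters
equal to `1` are added. -/
def resCoeff (k l : ℕ) (α β : ℕ → K) (a b : ℤ) : K := resSum k l (a + k - l) b α β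

/-- This is `z = 1 - (1 - z)` under the residue; it is the source of the exchange law. -/
theorem resCoeff_succ (k l : ℕ) (α β : ℕ → K) (a b : ℤ) :
    resCoeff k l α β a (b + 1) = resCoeff k l α β a b - resCoeff k l α β (a + 1) b := by
  rw [resCoeff, resCoeff, resCoeff, show a + 1 + k - l = a + k - (l : ℤ) + 1 by ring,
    resSum_exponent_succ]
  ring

theorem resCoeff_denom_stable (k k' l : ℕ) (α β : ℕ → K) (a b : ℤ) (hk : k ≤ k')
    (hα : ∀ s, k ≤ s → α s = 1) : resCoeff k' l α β a b = resCoeff k l α β a b := by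
  induction k', hk using Nat.le_induction with
  | base => rfl
  | succ m hm ih =>
    rw [← ih, resCoeff, resCoeff, ← resSum_denom_one m l _ b α β (hα m hm)]
    congr 1; push_cast; ring

theorem resCoeff_numer_stable (k l l' : ℕ) (α β : ℕ → K) (a b : ℤ) (hl : l ≤ l')
    (hβ : ∀ q, l ≤ q → β q = 1) : resCoeff k l' α β a b = resCoeff k l α β a b := by
  induction l', hl using Nat.le_induction with
  | base => rfl
  | succ m hm ih =>
    rw [← ih, resCoeff, resCoeff, resSum_numer_one k m _ b α β (hβ m hm)]
    congr 1; push_cast; ring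

theorem resCoeff_of_neg (k l : ℕ) (α β : ℕ → K) (a b : ℤ) (hb : 0 ≤ b) (h : a + b < 0) :
    resCoeff k l α β a b = if b = 0 then 1 else 0 :=
  resSum_of_neg k l _ b α β hb (by omega)

end Field

theorem sum_Icc_sub_telescope {A : Type*} [AddCommGroup A] (f : ℤ → A) {p q : ℤ} (h : p ≤ q) :
    ∑ k ∈ Finset.Icc (p + 1) q, (f (k - 1) - f k) = f p - f q := by
  induction q, h using Int.leInduction with
  | base => simp
  | succ m hm ih =>
    have : Finset.Icc (p + 1) (m + 1) = insert (m + 1) (Finset.Icc (p + 1) m) := by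
      ext x; simp only [Finset.mem_Icc, Finset.mem_insert]; omega
    rw [this, Finset.sum_insert (by simp), ih, add_sub_cancel_right]
    abel

/-! ### Straightening laws for determinants -/

section ShiftDet

variable {R : Type*} [CommRing R]

/-- The determinant of the matrix with entries `c_j(e_j - j, j - i)` for one-based `i, j`. -/
def shiftDet (c : ℕ → ℤ → ℤ → R) (r : ℕ) (e : ℕ → ℤ) : R :=
  Matrix.det (Matrix.of fun i j : Fin r => c j (e j - ((j : ℕ) + 1)) ((j : ℕ) - (i : ℕ)))

theorem shiftDet_congr {c c' : ℕ → ℤ → ℤ → R} {r : ℕ} {e e' : ℕ → ℤ}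
    (h : ∀ j < r, ∀ b, c j (e j - (j + 1)) b = c' j (e' j - (j + 1)) b) :
    shiftDet c r e = shiftDet c' r e' := by
  unfold shiftDet
  congr 1
  ext i j
  exact h j j.2 _

theorem detRow_update_swap {n : ℕ} (M : Fin n → Fin n → R) {s t : Fin n} (hst : s ≠ t)
    (u v : Fin n → R) :
    Matrix.detRowAlternating (Function.update (Function.update M s v) t u) =
      -Matrix.detRowAlternating (Function.update (Function.update M s u) t v) := by
  rw [← AlternatingMap.map_swap _ _ hst]
  congr 1
  funext i
  rw [Function.comp_apply]
  by_cases h1 : i = s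
  · subst h1
    rw [Equiv.swap_apply_left, Function.update_self, Function.update_of_ne hst,
      Function.update_self]
  · by_cases h2 : i = t
    · subst h2
      rw [Equiv.swap_apply_right, Function.update_self, Function.update_of_ne hst,
        Function.update_self]
    · rw [Equiv.swap_apply_of_ne_of_ne h1 h2, Function.update_of_ne h2, Function.update_of_ne h1,
        Function.update_of_ne h2, Function.update_of_ne h1]

/-- By the recurrence, column `s + 1` with entry `x` is `V (x - 1) - V x`, where `V` is the family
of columns at position `s`. With `B` the determinant as a function of the two columns, the left side
is `B (V p) (V (q - 1)) - B (V p) (V q)`. On the right the sums over `k` telescope to `B (V q) (V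
p)` and `B (V (q - 1)) (V p)`, since `B u u = 0`. -/
theorem shiftDet_exchange (c : ℤ → ℤ → R) (hc : ∀ a b, c a (b + 1) = c a b - c (a + 1) b)
    (r s : ℕ) (hs : s + 1 < r) (e : ℕ → ℤ) (hpq : e s < e (s + 1)) :
    shiftDet (fun _ => c) r e =
      ∑ k ∈ Finset.Icc (e s + 1) (e (s + 1)), shiftDet (fun _ => c) r
          (Function.update (Function.update e s (e (s + 1))) (s + 1) k) -
        ∑ k ∈ Finset.Icc (e s + 1) (e (s + 1) - 1), shiftDet (fun _ => c) r
          (Function.update (Function.update e s (e (s + 1) - 1)) (s + 1) k) := by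
  set S : Fin r := ⟨s, by omega⟩ with hS
  set T : Fin r := ⟨s + 1, hs⟩ with hT
  have hST : S ≠ T := by simp [hS, hT]
  set V : ℕ → ℤ → Fin r → R := fun j x i => c (x - (j + 1)) (j - (i : ℕ)) with hV
  set M : Fin r → Fin r → R := fun j => V j (e j) with hM
  -- Linearity is bundled only in the second argument, the one in which the sums over `k` are taken.
  set B : (Fin r → R) → (Fin r → R) →ₗ[R] R := fun u =>
    (Matrix.detRowAlternating (n := Fin r) (R := R)).toMultilinearMap.toLinearMap
      (Function.update M S u) T with hB
  have hBapp : ∀ u v, B u v =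
      Matrix.detRowAlternating (Function.update (Function.update M S u) T v) := fun _ _ => rfl
  have hdet : ∀ x y, shiftDet (fun _ => c) r
      (Function.update (Function.update e s x) (s + 1) y) = B (V s x) (V (s + 1) y) := by
    intro x y
    rw [hBapp, shiftDet, ← Matrix.det_transpose]
    change _ = Matrix.det _
    congr 1
    ext j i
    rw [Matrix.transpose_apply, Matrix.of_apply]
    by_cases h2 : j = T
    · subst h2
      simp [hV, hT]
    · have h2' : (j : ℕ) ≠ s + 1 := fun h => h2 (Fin.ext h)
      by_cases h1 : j = S
      · subst h1
        simp [hV, hS, hT]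
      · have h1' : (j : ℕ) ≠ s := fun h => h1 (Fin.ext h)
        rw [Function.update_of_ne h2, Function.update_of_ne h1, Function.update_of_ne h2',
          Function.update_of_ne h1']
  have hsucc : ∀ x, V (s + 1) x = V s (x - 1) - V s x := by
    intro x
    funext i
    have h := hc (x - 1 - (s + 1)) (s - (i : ℕ))
    simp only [hV, Pi.sub_apply]
    rw [show x - (((s + 1 : ℕ) : ℤ) + 1) = x - 1 - (s + 1) by push_cast; ring,
      show ((s + 1 : ℕ) : ℤ) - ((i : ℕ) : ℤ) = s - (i : ℕ) + 1 by push_cast; ring, h]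
    congr 2; ring
  have hskew : ∀ u v, B v u = -B u v := fun u v => detRow_update_swap M hST u v
  have hself : ∀ u, B u u = 0 := by
    intro u
    rw [hBapp]
    refine AlternatingMap.map_eq_zero_of_eq _ _ (i := S) (j := T) ?_ hST
    rw [Function.update_self, Function.update_of_ne hST, Function.update_self]
  have hsum : ∀ u q, e s ≤ q → ∑ k ∈ Finset.Icc (e s + 1) q, B u (V (s + 1) k) =
      B u (V s (e s)) - B u (V s q) := by
    intro u q hq
    rw [← map_sum, Finset.sum_congr rfl fun k _ => hsucc k, sum_Icc_sub_telescope (V s) hq, map_sub]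
  have h0 : e = Function.update (Function.update e s (e s)) (s + 1) (e (s + 1)) := by simp
  conv_lhs => rw [h0]
  simp only [hdet]
  rw [hsum _ _ hpq.le, hsum _ _ (by omega), hself, hself, hsucc, map_sub,
    hskew (V s (e s)) (V s (e (s + 1))), hskew (V s (e s)) (V s (e (s + 1) - 1))]
  ring

/-- The last column is the last unit vector, so Laplace expansion along it removes one row and one
column. -/
theorem shiftDet_succ (c : ℕ → ℤ → ℤ → R) (r : ℕ) (e : ℕ → ℤ)
    (h : ∀ b : ℤ, 0 ≤ b → b ≤ r → c r (e r - (r + 1)) b = if b = 0 then 1 else 0) :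
    shiftDet c (r + 1) e = shiftDet c r e := by
  unfold shiftDet
  rw [Matrix.det_succ_column _ (Fin.last r), Finset.sum_eq_single (Fin.last r)]
  · have h1 : (-1 : R) ^ (r + r) = 1 := (Even.add_self r).neg_one_pow
    simp only [Fin.val_last, Matrix.of_apply]
    rw [h1, h _ (by omega) (by omega), if_pos (by omega), one_mul, one_mul]
    congr 1
    ext i j
    simp
  · intro i _ hi
    have hi' : (i : ℕ) ≠ r := fun h => hi (Fin.ext h)
    simp only [Fin.val_last, Matrix.of_apply]
    rw [h _ (by omega) (by omega), if_neg (by omega)]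
    ring
  · simp

end ShiftDet

/-! ### The determinant of residue sums -/

section Field

variable {K : Type*} [Field K]

/-- The determinant expression of the iterated residue. -/
def resDet (k : ℕ) (L : ℕ → ℕ) (α β : ℕ → K) (r : ℕ) (e : ℕ → ℤ) : K :=
  shiftDet (fun j => resCoeff k (L j) α β) r e

theorem resDet_succ (k : ℕ) (L : ℕ → ℕ) (α β : ℕ → K) (r : ℕ) (e : ℕ → ℤ) (h : e r ≤ 0) :
    resDet k L α β (r + 1) e = resDet k L α β r e :=
  shiftDet_succ _ _ _ fun b hb hbr => resCoeff_of_neg _ _ _ _ _ _ hb (by omega)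

theorem resDet_extend (k : ℕ) (L : ℕ → ℕ) (α β : ℕ → K) {r r' : ℕ} (e : ℕ → ℤ) (hr : r ≤ r')
    (h : ∀ j, r ≤ j → e j ≤ 0) : resDet k L α β r' e = resDet k L α β r e := by
  induction r', hr using Nat.le_induction with
  | base => rfl
  | succ m hm ih => rw [resDet_succ _ _ _ _ _ _ (h m hm), ih]

theorem resDet_exchange (k l : ℕ) (α β : ℕ → K) (r s : ℕ) (hs : s + 1 < r) (e : ℕ → ℤ)
    (hpq : e s < e (s + 1)) :
    resDet k (fun _ => l) α β r e =
      ∑ k' ∈ Finset.Icc (e s + 1) (e (s + 1)), resDet k (fun _ => l) α β r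
          (Function.update (Function.update e s (e (s + 1))) (s + 1) k') -
        ∑ k' ∈ Finset.Icc (e s + 1) (e (s + 1) - 1), resDet k (fun _ => l) α β r
          (Function.update (Function.update e s (e (s + 1) - 1)) (s + 1) k') :=
  shiftDet_exchange _ (resCoeff_succ k l α β) r s hs e hpq

theorem resDet_congr_exponent (k : ℕ) (L : ℕ → ℕ) (α β : ℕ → K) (r : ℕ) {e e' : ℕ → ℤ}
    (h : ∀ j < r, e j = e' j) : resDet k L α β r e = resDet k L α β r e' :=
  shiftDet_congr fun j hj b => by rw [h j hj]

/-- Different columns may use different numbers of `β`'s, as the Grassmannian formula requires;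
surplus parameters equal to `1` drop out column by column. -/
theorem resDet_stable {k k' l : ℕ} {L : ℕ → ℕ} (α β : ℕ → K) (r : ℕ) (e : ℕ → ℤ) (hk : k ≤ k')
    (hL : ∀ j < r, l ≤ L j) (hα : ∀ s, k ≤ s → α s = 1) (hβ : ∀ q, l ≤ q → β q = 1) :
    resDet k' L α β r e = resDet k (fun _ => l) α β r e :=
  shiftDet_congr fun j hj b => by
    rw [resCoeff_denom_stable k k' _ α β _ b hk hα,
      resCoeff_numer_stable k l _ α β _ b (hL j hj) hβ]

end Field

/-! ### Polynomiality of the determinant -/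

section Universal

variable {R S : Type*} [CommRing R] [CommRing S]

/-- The entries of the product of the lower unitriangular Toeplitz matrix with entries the
coefficients of `∏ (1 - α_s z)` and of the matrix of residue sums, as polynomials in
`a_s = 1 / α_s` and `β_q`. -/
def toeplitzEntry (k l : ℕ) (n : ℤ) (a β : ℕ → R) (i j : ℕ) : R :=
  intCoeff (numerZero l n β) (i - j) - ((n + k).negOnePow : ℤ) *
    ∑ u ∈ Finset.range (i + 1),
      PowerSeries.coeff u (∏ s ∈ Finset.range k, (PowerSeries.C (a s) - PowerSeries.X)) *
        intCoeff (seriesInfty k l n a β) (n - k + l + (j - (i - u)))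

theorem map_toeplitzEntry (f : R →+* S) (k l : ℕ) (n : ℤ) (a β : ℕ → R) (i j : ℕ) :
    f (toeplitzEntry k l n a β i j) =
      toeplitzEntry k l n (fun s => f (a s)) (fun q => f (β q)) i j := by
  simp only [toeplitzEntry, map_sub, map_mul, map_sum, ← intCoeff_map, map_numerZero,
    map_seriesInfty, map_intCast, ← PowerSeries.coeff_map, map_prod, PowerSeries.map_C,
    PowerSeries.map_X]

end Universal

section Field

variable {K : Type*} [Field K]

/-- Convolution with the coefficients of `∏ (1 - α_s z)` cancels the denominator of the expansion at
`0`. At `∞` the prefactor `∏ α_s⁻¹` merges with it into `∏ (α_s⁻¹ - z)`. Hence only `α_s⁻¹` and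
`β_q` remain, polynomially. -/
theorem sum_coeff_mul_resSum (k l : ℕ) (n : ℤ) (α β : ℕ → K) (hα : ∀ s, α s ≠ 0) (i j : ℕ) :
    ∑ u ∈ Finset.range (i + 1), PowerSeries.coeff u
        (∏ s ∈ Finset.range k, (1 - PowerSeries.C (α s) * PowerSeries.X)) *
          resSum k l n (j - (i - u)) α β =
      toeplitzEntry k l n (fun s => (α s)⁻¹) β i j := by
  have hE : (∏ s ∈ Finset.range k, (1 - PowerSeries.C (α s) * PowerSeries.X)) *
      seriesZero k l n α β = numerZero l n β := by
    rw [seriesZero, mul_left_comm, ← Finset.prod_mul_distrib]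
    simp [one_sub_mul_geomSeries]
  have ha : ∏ s ∈ Finset.range k, (PowerSeries.C (α s)⁻¹ - PowerSeries.X) =
      PowerSeries.C (∏ s ∈ Finset.range k, (α s)⁻¹) *
        ∏ s ∈ Finset.range k, (1 - PowerSeries.C (α s) * PowerSeries.X) := by
    rw [map_prod, ← Finset.prod_mul_distrib]
    refine Finset.prod_congr rfl fun s _ => ?_
    rw [mul_sub, ← mul_assoc, ← map_mul, inv_mul_cancel₀ (hα s)]; simp
  rw [toeplitzEntry, ← hE, intCoeff_mul _ _ _ (i + 1) (by push_cast; omega), ha, Finset.mul_sum,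
    ← Finset.sum_sub_distrib]
  refine Finset.sum_congr rfl fun u _ => ?_
  rw [resSum, PowerSeries.coeff_C_mul, Int.cast_negOnePow,
    show -((j : ℤ) - (i - u)) = i - j - u by ring]
  ring

/-- The universal polynomial of `resDet` in the variables `x_i = 1 - 1 / α_i` and
`y_j = 1 - β_j`. -/
def resPoly (k : ℕ) (L : ℕ → ℕ) (r : ℕ) (e : ℕ → ℤ) : MvPolynomial (ℕ ⊕ ℕ) ℤ :=
  Matrix.det (Matrix.of fun i j : Fin r =>
    toeplitzEntry k (L j) (e j - ((j : ℕ) + 1) + k - L j)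
      (fun s => 1 - MvPolynomial.X (Sum.inl s)) (fun q => 1 - MvPolynomial.X (Sum.inr q)) i j)

/-- Left multiplication by the unitriangular Toeplitz matrix of `∏ (1 - α_s z)` preserves the
determinant and makes every entry polynomial in the `α_s⁻¹` and `β_q`. -/
theorem aeval_resPoly [Algebra ℤ K] (k : ℕ) (L : ℕ → ℕ) (r : ℕ) (e : ℕ → ℤ) (α β : ℕ → K)
    (hα : ∀ s, α s ≠ 0) :
    MvPolynomial.aeval (Sum.elim (fun i => 1 - (α i)⁻¹) (fun j => 1 - β j)) (resPoly k L r e) =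
      resDet k L α β r e := by
  set E : PowerSeries K := ∏ s ∈ Finset.range k, (1 - PowerSeries.C (α s) * PowerSeries.X) with hE
  set T : Matrix (Fin r) (Fin r) K := Matrix.of fun i i' =>
    if i' ≤ i then PowerSeries.coeff ((i : ℕ) - (i' : ℕ)) E else 0 with hT
  have hdet : T.det = 1 := by
    rw [Matrix.det_of_isLowerTriangular]
    · refine Finset.prod_eq_one fun i _ => ?_
      simp only [hT, Matrix.of_apply, le_refl, if_true, Nat.sub_self,
        PowerSeries.coeff_zero_eq_constantCoeff_apply]
      simp [hE, map_prod]
    · intro i i' h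
      have h' : i < i' := h
      simp [hT, not_le.2 h']
  have hmul : ∀ A : Matrix (Fin r) (Fin r) K, A.det = (T * A).det := fun A => by
    rw [Matrix.det_mul, hdet, one_mul]
  rw [resDet, shiftDet, hmul, resPoly, AlgHom.map_det]
  congr 1
  ext i j
  rw [AlgHom.mapMatrix_apply, Matrix.map_apply, Matrix.of_apply, Matrix.mul_apply]
  have h1 := map_toeplitzEntry ((MvPolynomial.aeval (Sum.elim (fun i => 1 - (α i)⁻¹)
    (fun j => 1 - β j)) : MvPolynomial (ℕ ⊕ ℕ) ℤ →ₐ[ℤ] K) : MvPolynomial (ℕ ⊕ ℕ) ℤ →+* K)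
    k (L j) (e j - ((j : ℕ) + 1) + k - L j)
      (fun s => 1 - MvPolynomial.X (Sum.inl s)) (fun q => 1 - MvPolynomial.X (Sum.inr q)) i j
  simp only [RingHom.coe_coe, map_sub, map_one, MvPolynomial.aeval_X, Sum.elim_inl, Sum.elim_inr,
    sub_sub_cancel] at h1
  rw [h1, ← sum_coeff_mul_resSum k (L j) _ α β hα]
  have hi : (i : ℕ) < r := i.2
  set f : ℕ → K := fun i' => resSum k (L j) (e j - ((j : ℕ) + 1) + k - L j) ((j : ℕ) - i') α β with hf
  have h2 : ∑ i' : Fin r, T i i' * f i' =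
      ∑ i' ∈ Finset.range r, (if i' ≤ (i : ℕ) then PowerSeries.coeff ((i : ℕ) - i') E * f i' else 0) := by
    rw [← Fin.sum_univ_eq_sum_range
      (fun i' => if i' ≤ (i : ℕ) then PowerSeries.coeff ((i : ℕ) - i') E * f i' else 0)]
    refine Finset.sum_congr rfl fun i' _ => ?_
    simp only [hT, Matrix.of_apply, Fin.le_def]
    split_ifs <;> simp
  refine Eq.trans ?_ h2.symm
  have hsub : Finset.range ((i : ℕ) + 1) ⊆ Finset.range r := by
    intro u; simp only [Finset.mem_range]; omega
  -- The convolution index `u` corresponds to the matrix index `i' = i - u`.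
  rw [← Finset.sum_subset hsub, ← Finset.sum_range_reflect]
  · refine Finset.sum_congr rfl fun u hu => ?_
    rw [Finset.mem_range] at hu
    rw [if_pos (by omega), hf, show (i : ℕ) + 1 - 1 - u = i - u by omega]
    simp only
    rw [Nat.cast_sub (by omega)]
    congr 3; ring
  · intro u _ hu
    rw [Finset.mem_range] at hu
    rw [if_neg (by omega)]

end Field

/-! ### Injectivity of the change of variables -/

theorem alpha_ne_zero (i : ℕ) : alpha i ≠ 0 := by
  rw [alpha, Ne, FaithfulSMul.algebraMap_eq_zero_iff]
  exact MvPolynomial.X_ne_zero _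

theorem alpha_injective : Function.Injective alpha := by
  intro i j h
  have h1 := FaithfulSMul.algebraMap_injective (MvPolynomial (ℕ ⊕ ℕ) ℤ) RatField h
  exact Sum.inl_injective (MvPolynomial.X_injective h1)

theorem alpha_ne_one (i : ℕ) : alpha i ≠ 1 := by
  rw [alpha, ← map_one (algebraMap (MvPolynomial (ℕ ⊕ ℕ) ℤ) RatField)]
  intro h
  have h1 := FaithfulSMul.algebraMap_injective (MvPolynomial (ℕ ⊕ ℕ) ℤ) RatField h
  have h2 := congrArg (MvPolynomial.aeval fun _ => (0 : ℤ)) h1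
  simp at h2

/-- One pair `m`, `R` has to work for all nonzero `α`, because uniqueness uses it at two different
points: the generic one and one where the substitution is undone. -/
theorem exists_clear_denominators (P : MvPolynomial (ℕ ⊕ ℕ) ℤ) :
    ∃ m R : MvPolynomial (ℕ ⊕ ℕ) ℤ, ∀ α β : ℕ → RatField, (∀ i, α i ≠ 0) →
      MvPolynomial.aeval (Sum.elim α β) m ≠ 0 ∧
      MvPolynomial.aeval (Sum.elim α β) R = MvPolynomial.aeval (Sum.elim α β) m *
        MvPolynomial.aeval (Sum.elim (fun i => 1 - (α i)⁻¹) (fun j => 1 - β j)) P := by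
  induction P using MvPolynomial.induction_on with
  | C c => exact ⟨1, MvPolynomial.C c, fun α β hα => by simp⟩
  | add P Q hP hQ =>
    obtain ⟨m, R, h⟩ := hP
    obtain ⟨m', R', h'⟩ := hQ
    refine ⟨m * m', m' * R + m * R', fun α β hα => ⟨?_, ?_⟩⟩
    · rw [map_mul]; exact mul_ne_zero (h α β hα).1 (h' α β hα).1
    · rw [map_add, map_mul, map_mul, (h α β hα).2, (h' α β hα).2, map_mul, map_add]; ring
  | mul_X P v hP =>
    obtain ⟨m, R, h⟩ := hP
    rcases v with i | j
    · refine ⟨m * MvPolynomial.X (Sum.inl i), R * (MvPolynomial.X (Sum.inl i) - 1),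
        fun α β hα => ⟨?_, ?_⟩⟩
      · rw [map_mul, MvPolynomial.aeval_X]; exact mul_ne_zero (h α β hα).1 (hα i)
      · simp only [map_mul, map_sub, map_one, MvPolynomial.aeval_X, (h α β hα).2, Sum.elim_inl]
        have := hα i
        field_simp
    · refine ⟨m, R * (1 - MvPolynomial.X (Sum.inr j)), fun α β hα => ⟨(h α β hα).1, ?_⟩⟩
      simp only [map_mul, map_sub, map_one, MvPolynomial.aeval_X, (h α β hα).2, Sum.elim_inr]
      ring

theorem aeval_alpha_beta (P : MvPolynomial (ℕ ⊕ ℕ) ℤ) :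
    MvPolynomial.aeval (Sum.elim alpha beta) P =
      algebraMap (MvPolynomial (ℕ ⊕ ℕ) ℤ) RatField P := by
  have h : MvPolynomial.aeval (Sum.elim alpha beta) =
      (Algebra.ofId (MvPolynomial (ℕ ⊕ ℕ) ℤ) RatField).restrictScalars ℤ := by
    refine MvPolynomial.algHom_ext fun v => ?_
    rw [MvPolynomial.aeval_X]
    rcases v with i | j <;> rfl
  rw [h]; rfl

/-- Rewriting by `x_i = 1 - 1 / α_i`, `y_j = 1 - β_j` is injective. -/
theorem IsRewrittenAs.unique {f : RatField} {P Q : MvPolynomial (ℕ ⊕ ℕ) ℤ}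
    (hP : IsRewrittenAs f P) (hQ : IsRewrittenAs f Q) : P = Q := by
  rw [← sub_eq_zero]
  have h0 : MvPolynomial.aeval
      (Sum.elim (fun i => 1 - (alpha i)⁻¹) (fun j => 1 - beta j)) (P - Q) = 0 := by
    rw [map_sub, hP, hQ, sub_self]
  obtain ⟨m, R, h⟩ := exists_clear_denominators (P - Q)
  have h1 := (h alpha beta alpha_ne_zero).2
  rw [h0, mul_zero, aeval_alpha_beta, FaithfulSMul.algebraMap_eq_zero_iff] at h1
  have hne : ∀ i, 1 - alpha i ≠ 0 := fun i => sub_ne_zero.2 (alpha_ne_one i).symm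
  -- At the generic point `R` was seen to vanish. The point `α' = 1 / (1 - α)`, `β' = 1 - β`
  -- satisfies `1 - 1 / α' = α` and `1 - β' = β`, so here the same identity reads `0 = m · P(α, β)`.
  obtain ⟨hm, h2⟩ := h (fun i => (1 - alpha i)⁻¹) (fun j => 1 - beta j)
    fun i => inv_ne_zero (hne i)
  simp only [h1, map_zero, inv_inv, sub_sub_cancel] at h2
  have h3 := (mul_eq_zero.1 h2.symm).resolve_left hm
  rw [aeval_alpha_beta, FaithfulSMul.algebraMap_eq_zero_iff] at h3
  exact h3

theorem isRewrittenAs_resPoly (k : ℕ) (L : ℕ → ℕ) (r : ℕ) (e : ℕ → ℤ) :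
    IsRewrittenAs (resDet k L alpha beta r e) (resPoly k L r e) :=
  aeval_resPoly k L r e alpha beta alpha_ne_zero

/-! ### Truncation and the limiting power series -/

/-- The inclusion of the first `k` and the first `l` variables. -/
def varInc (k l : ℕ) : Fin k ⊕ Fin l → ℕ ⊕ ℕ :=
  Sum.map (Fin.val : Fin k → ℕ) (Fin.val : Fin l → ℕ)

theorem varInc_injective (k l : ℕ) : Function.Injective (varInc k l) :=
  Sum.map_injective.2 ⟨Fin.val_injective, Fin.val_injective⟩

/-- Extension of a finite sequence by ones. -/
def extendOne {K : Type*} [One K] {k : ℕ} (v : Fin k → K) (i : ℕ) : K :=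
  if h : i < k then v ⟨i, h⟩ else 1

@[simp] theorem extendOne_val {K : Type*} [One K] {k : ℕ} (v : Fin k → K) (i : Fin k) :
    extendOne v i = v i := by simp [extendOne]

theorem extendOne_of_le {K : Type*} [One K] {k : ℕ} (v : Fin k → K) {i : ℕ} (h : k ≤ i) :
    extendOne v i = 1 := by simp [extendOne, h]

section Field

variable {K : Type*} [Field K]

/-- Setting `x_i` or `y_j` to `0` is the same as setting `α_i` or `β_j` to `1`. -/
theorem aeval_killCompl_varInc [Algebra ℤ K] {k l : ℕ} (α : Fin k → K) (β : Fin l → K)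
    (P : MvPolynomial (ℕ ⊕ ℕ) ℤ) :
    MvPolynomial.aeval (Sum.elim (fun i => 1 - (α i)⁻¹) (fun j => 1 - β j))
        (MvPolynomial.killCompl (varInc_injective k l) P) =
      MvPolynomial.aeval (Sum.elim (fun i => 1 - (extendOne α i)⁻¹)
        (fun j => 1 - extendOne β j)) P := by
  rw [← AlgHom.comp_apply]
  congr 1
  refine MvPolynomial.algHom_ext fun v => ?_
  rw [AlgHom.comp_apply, MvPolynomial.aeval_X]
  by_cases hv : v ∈ Set.range (varInc k l)
  · obtain ⟨u, rfl⟩ := hv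
    rw [← MvPolynomial.rename_X (R := ℤ), MvPolynomial.killCompl_rename_app,
      MvPolynomial.aeval_X]
    rcases u with i | j <;> simp [varInc]
  · rw [MvPolynomial.killCompl, MvPolynomial.aeval_X, dif_neg hv, map_zero]
    rcases v with i | j
    · have : k ≤ i := not_lt.1 fun h => hv ⟨Sum.inl ⟨i, h⟩, rfl⟩
      simp [extendOne_of_le α this]
    · have : l ≤ j := not_lt.1 fun h => hv ⟨Sum.inr ⟨j, h⟩, rfl⟩
      simp [extendOne_of_le β this]

theorem extendOne_ne_zero {k : ℕ} {α : Fin k → K} (hα : ∀ i, α i ≠ 0) (i : ℕ) :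
    extendOne α i ≠ 0 := by
  unfold extendOne; split_ifs
  · exact hα _
  · exact one_ne_zero

theorem aeval_killCompl_resPoly [Algebra ℤ K] {k l : ℕ} (α : Fin k → K) (β : Fin l → K) (hα : ∀ i, α i ≠ 0)
    (k' : ℕ) (L : ℕ → ℕ) (r : ℕ) (e : ℕ → ℤ) (hk : k ≤ k') (hL : ∀ j < r, l ≤ L j) :
    MvPolynomial.aeval (Sum.elim (fun i => 1 - (α i)⁻¹) (fun j => 1 - β j))
        (MvPolynomial.killCompl (varInc_injective k l) (resPoly k' L r e)) =
      resDet k (fun _ => l) (extendOne α) (extendOne β) r e := by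
  rw [aeval_killCompl_varInc, aeval_resPoly _ _ _ _ _ _ (extendOne_ne_zero hα)]
  exact resDet_stable _ _ r e hk hL (fun _ => extendOne_of_le α) (fun _ => extendOne_of_le β)

end Field

/-- At generic arguments both truncations evaluate to the determinant with parameters extended by
ones, where the surplus ones do not matter; injectivity of the substitution then gives equality of
polynomials. -/
theorem killCompl_resPoly (k l k' : ℕ) (L : ℕ → ℕ) (r : ℕ) (e : ℕ → ℤ) (hk : k ≤ k')
    (hL : ∀ j < r, l ≤ L j) :
    MvPolynomial.killCompl (varInc_injective k l) (resPoly k' L r e) =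
      MvPolynomial.killCompl (varInc_injective k l) (resPoly k (fun _ => l) r e) := by
  apply MvPolynomial.rename_injective _ (varInc_injective k l)
  have key : ∀ P : MvPolynomial (Fin k ⊕ Fin l) ℤ, IsRewrittenAs
      (MvPolynomial.aeval (Sum.elim (fun i : Fin k => 1 - (alpha i)⁻¹)
        (fun j : Fin l => 1 - beta j)) P) (MvPolynomial.rename (varInc k l) P) := by
    intro P
    rw [IsRewrittenAs, MvPolynomial.aeval_rename]
    congr 2
    funext v
    rcases v with i | j <;> rfl
  refine IsRewrittenAs.unique (key _) ?_
  rw [aeval_killCompl_resPoly _ _ (fun i => alpha_ne_zero i) k' L r e hk hL,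
    ← aeval_killCompl_resPoly (fun i : Fin k => alpha i) (fun i : Fin l => beta i)
      (fun i => alpha_ne_zero i) k (fun _ => l) r e le_rfl (fun _ _ => le_rfl)]
  exact key _

/-- A bound for the indices of the variables in a monomial. -/
def varBound (d : (ℕ ⊕ ℕ) →₀ ℕ) : ℕ := d.support.sup (Sum.elim id id) + 1

theorem exists_mapDomain_varInc (d : (ℕ ⊕ ℕ) →₀ ℕ) :
    ∃ d', d = Finsupp.mapDomain (varInc (varBound d) (varBound d)) d' := by
  refine ⟨d.comapDomain _ (varInc_injective _ _).injOn,
    (Finsupp.mapDomain_comapDomain _ (varInc_injective _ _) _ fun v hv => ?_).symm⟩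
  have h : Sum.elim id id v < varBound d :=
    Nat.lt_succ_of_le (Finset.le_sup (f := Sum.elim id id) (Finset.mem_coe.1 hv))
  rcases v with i | j
  · exact ⟨Sum.inl ⟨i, h⟩, rfl⟩
  · exact ⟨Sum.inr ⟨j, h⟩, rfl⟩

/-- The power series with the coefficients of the polynomials `resPoly` in sufficiently many
variables. -/
def resSeries (r : ℕ) (e : ℕ → ℤ) : MvPowerSeries (ℕ ⊕ ℕ) ℤ := fun d =>
  MvPolynomial.coeff d (resPoly (varBound d) (fun _ => varBound d) r e)

/-- Killing the variables beyond `varBound d` does not affect the monomial `d`, and what is left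
does not depend on `k` and `L`. -/
theorem coeff_resPoly (d : (ℕ ⊕ ℕ) →₀ ℕ) (k : ℕ) (L : ℕ → ℕ) (r : ℕ) (e : ℕ → ℤ)
    (hk : varBound d ≤ k) (hL : ∀ j < r, varBound d ≤ L j) :
    MvPolynomial.coeff d (resPoly k L r e) = MvPowerSeries.coeff d (resSeries r e) := by
  obtain ⟨d', hd'⟩ := exists_mapDomain_varInc d
  have h := congrArg (MvPolynomial.coeff d') (killCompl_resPoly _ _ k L r e hk hL)
  rw [MvPolynomial.coeff_killCompl, MvPolynomial.coeff_killCompl, ← hd'] at h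
  exact h

theorem truncate_resSeries (k l r : ℕ) (e : ℕ → ℤ) :
    ((MvPolynomial.killCompl (varInc_injective k l) (resPoly k (fun _ => l) r e) :
        MvPolynomial (Fin k ⊕ Fin l) ℤ) : MvPowerSeries (Fin k ⊕ Fin l) ℤ) =
      truncate k l (resSeries r e) := by
  ext d'
  set d := Finsupp.mapDomain (varInc k l) d' with hd
  change _ = MvPowerSeries.coeff d (resSeries r e)
  set B := max (max k l) (varBound d)
  rw [← coeff_resPoly d B (fun _ => B) r e (le_max_right _ _) (fun _ _ => le_max_right _ _),
    MvPolynomial.coeff_coe,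
    ← killCompl_resPoly k l B (fun _ => B) r e (le_trans (le_max_left _ _) (le_max_left _ _))
      (fun _ _ => le_trans (le_max_right _ _) (le_max_left _ _)), MvPolynomial.coeff_killCompl]

/-- Identities of determinants at the generic point lift to the universal polynomials, and from
there to `resSeries` coefficientwise. -/
theorem resPoly_eq_of_resDet_eq {k : ℕ} {L : ℕ → ℕ} {r r' : ℕ} {e e' : ℕ → ℤ}
    (h : resDet k L alpha beta r e = resDet k L alpha beta r' e') :
    resPoly k L r e = resPoly k L r' e' :=
  IsRewrittenAs.unique (isRewrittenAs_resPoly k L r e) (h ▸ isRewrittenAs_resPoly k L r' e')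

theorem resSeries_congr (r : ℕ) {e e' : ℕ → ℤ} (h : ∀ j < r, e j = e' j) :
    resSeries r e = resSeries r e' := by
  ext d
  exact congrArg (MvPolynomial.coeff d) (resPoly_eq_of_resDet_eq (resDet_congr_exponent _ _ _ _ r h))

theorem resSeries_succ (r : ℕ) (e : ℕ → ℤ) (h : e r ≤ 0) :
    resSeries (r + 1) e = resSeries r e := by
  ext d
  exact congrArg (MvPolynomial.coeff d) (resPoly_eq_of_resDet_eq (resDet_succ _ _ _ _ r e h))

theorem resSeries_exchange (r s : ℕ) (hs : s + 1 < r) (e : ℕ → ℤ) (hpq : e s < e (s + 1)) :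
    resSeries r e =
      ∑ k ∈ Finset.Icc (e s + 1) (e (s + 1)), resSeries r
          (Function.update (Function.update e s (e (s + 1))) (s + 1) k) -
        ∑ k ∈ Finset.Icc (e s + 1) (e (s + 1) - 1), resSeries r
          (Function.update (Function.update e s (e (s + 1) - 1)) (s + 1) k) := by
  ext d
  rw [map_sub, map_sum, map_sum]
  set B := varBound d
  have h : resPoly B (fun _ => B) r e =
      ∑ k ∈ Finset.Icc (e s + 1) (e (s + 1)), resPoly B (fun _ => B) r
          (Function.update (Function.update e s (e (s + 1))) (s + 1) k) -
        ∑ k ∈ Finset.Icc (e s + 1) (e (s + 1) - 1), resPoly B (fun _ => B) r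
          (Function.update (Function.update e s (e (s + 1) - 1)) (s + 1) k) := by
    refine IsRewrittenAs.unique (isRewrittenAs_resPoly _ _ _ _) ?_
    rw [IsRewrittenAs, map_sub, map_sum, map_sum, resDet_exchange _ _ _ _ r s hs e hpq]
    exact congrArg₂ _ (Finset.sum_congr rfl fun k _ => isRewrittenAs_resPoly _ _ _ _)
      (Finset.sum_congr rfl fun k _ => isRewrittenAs_resPoly _ _ _ _)
  have h' := congrArg (MvPolynomial.coeff d) h
  rw [MvPolynomial.coeff_sub, MvPolynomial.coeff_sum, MvPolynomial.coeff_sum] at h'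
  exact h'

/-! ### Inversions, codes, and existence of the recursion's value -/

section Permutations

variable {n : ℕ}

/-- The transposition of two neighbouring letters. -/
abbrev adjSwap (i : ℕ) (hi : i + 1 < n) : Equiv.Perm (Fin n) :=
  Equiv.swap ⟨i, Nat.lt_of_succ_lt hi⟩ ⟨i + 1, hi⟩

theorem adjSwap_left (i : ℕ) (hi : i + 1 < n) :
    adjSwap i hi ⟨i, Nat.lt_of_succ_lt hi⟩ = ⟨i + 1, hi⟩ := Equiv.swap_apply_left _ _

theorem adjSwap_right (i : ℕ) (hi : i + 1 < n) :
    adjSwap i hi ⟨i + 1, hi⟩ = ⟨i, Nat.lt_of_succ_lt hi⟩ := Equiv.swap_apply_right _ _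

theorem adjSwap_of_ne (i : ℕ) (hi : i + 1 < n) (j : Fin n) (h1 : (j : ℕ) ≠ i)
    (h2 : (j : ℕ) ≠ i + 1) : adjSwap i hi j = j :=
  Equiv.swap_apply_of_ne_of_ne (fun h => h1 (congrArg Fin.val h)) fun h => h2 (congrArg Fin.val h)

/-- The code of a permutation: the numbers of inversions with a given first position. -/
def code (u : Equiv.Perm (Fin n)) (i : Fin n) : ℕ :=
  (Finset.univ.filter fun j : Fin n => i < j ∧ u j < u i).card

theorem invCount_eq_sum_code (u : Equiv.Perm (Fin n)) : invCount u = ∑ i, code u i := by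
  simp only [invCount, code, Finset.card_filter, Fintype.sum_prod_type]

/-- Swapping the values at an ascent exchanges the two code entries and creates one new inversion,
which is counted at position `i`. -/
theorem code_mul_adjSwap (u : Equiv.Perm (Fin n)) (i : ℕ) (hi : i + 1 < n)
    (h : u ⟨i, Nat.lt_of_succ_lt hi⟩ < u ⟨i + 1, hi⟩) (j : Fin n) :
    code (u * adjSwap i hi) j =
      code u (adjSwap i hi j) + if (j : ℕ) = i then 1 else 0 := by
  have h0 : code (u * adjSwap i hi) j = (Finset.univ.filter fun j' : Fin n =>
      j < adjSwap i hi j' ∧ u j' < u (adjSwap i hi j)).card := by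
    rw [code]
    refine Finset.card_equiv (adjSwap i hi) fun j' => ?_
    rw [Finset.mem_filter, Finset.mem_filter]
    simp only [Finset.mem_univ, true_and, Equiv.Perm.mul_apply]
    rw [Equiv.swap_apply_self]
  rw [h0]
  by_cases h1 : (j : ℕ) = i
  · obtain rfl : j = ⟨i, Nat.lt_of_succ_lt hi⟩ := Fin.ext h1
    rw [if_pos rfl, adjSwap_left, code, ← Finset.card_insert_of_notMem
      (a := ⟨i, Nat.lt_of_succ_lt hi⟩) (by simp)]
    congr 1
    ext j'
    simp only [Finset.mem_filter_univ, Finset.mem_insert]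
    by_cases e1 : (j' : ℕ) = i
    · obtain rfl : j' = ⟨i, Nat.lt_of_succ_lt hi⟩ := Fin.ext e1
      simp [h]
    · by_cases e2 : (j' : ℕ) = i + 1
      · obtain rfl : j' = ⟨i + 1, hi⟩ := Fin.ext e2
        simp
      · rw [adjSwap_of_ne _ _ _ e1 e2]
        simp only [Fin.lt_def, Fin.ext_iff]
        omega
  · rw [if_neg h1, add_zero]
    by_cases h2 : (j : ℕ) = i + 1
    · obtain rfl : j = ⟨i + 1, hi⟩ := Fin.ext h2
      rw [adjSwap_right, code]
      congr 1
      ext j'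
      simp only [Finset.mem_filter_univ]
      by_cases e1 : (j' : ℕ) = i
      · obtain rfl : j' = ⟨i, Nat.lt_of_succ_lt hi⟩ := Fin.ext e1
        simp
      · by_cases e2 : (j' : ℕ) = i + 1
        · obtain rfl : j' = ⟨i + 1, hi⟩ := Fin.ext e2
          simp [h.le]
        · rw [adjSwap_of_ne _ _ _ e1 e2]
          simp only [Fin.lt_def]
          omega
    · rw [adjSwap_of_ne _ _ _ h1 h2, code]
      congr 1
      ext j'
      simp only [Finset.mem_filter_univ]
      by_cases e1 : (j' : ℕ) = i
      · obtain rfl : j' = ⟨i, Nat.lt_of_succ_lt hi⟩ := Fin.ext e1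
        rw [adjSwap_left]
        simp only [Fin.lt_def]
        omega
      · by_cases e2 : (j' : ℕ) = i + 1
        · obtain rfl : j' = ⟨i + 1, hi⟩ := Fin.ext e2
          rw [adjSwap_right]
          simp only [Fin.lt_def]
          omega
        · rw [adjSwap_of_ne _ _ _ e1 e2]

theorem invCount_mul_adjSwap (u : Equiv.Perm (Fin n)) (i : ℕ) (hi : i + 1 < n)
    (h : u ⟨i, Nat.lt_of_succ_lt hi⟩ < u ⟨i + 1, hi⟩) :
    invCount (u * adjSwap i hi) = invCount u + 1 := by
  rw [invCount_eq_sum_code, invCount_eq_sum_code, Finset.sum_congr rfl fun j _ =>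
    code_mul_adjSwap u i hi h j, Finset.sum_add_distrib, Equiv.sum_comp (adjSwap i hi) (code u)]
  congr 1
  rw [Finset.sum_eq_single (⟨i, Nat.lt_of_succ_lt hi⟩ : Fin n)]
  · simp
  · intro b _ hb
    exact if_neg fun h => hb (Fin.ext h)
  · simp

theorem lt_of_invCount_mul_adjSwap (u : Equiv.Perm (Fin n)) (i : ℕ) (hi : i + 1 < n)
    (h : invCount (u * adjSwap i hi) = invCount u + 1) :
    u ⟨i, Nat.lt_of_succ_lt hi⟩ < u ⟨i + 1, hi⟩ := by
  by_contra hlt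
  have hne : u ⟨i + 1, hi⟩ ≠ u ⟨i, Nat.lt_of_succ_lt hi⟩ := fun h => by
    have := congrArg Fin.val (u.injective h)
    simp at this
  have h1 : u ⟨i + 1, hi⟩ < u ⟨i, Nat.lt_of_succ_lt hi⟩ := lt_of_le_of_ne (not_lt.1 hlt) hne
  have h2 := invCount_mul_adjSwap (u * adjSwap i hi) i hi (by
    rw [Equiv.Perm.mul_apply, Equiv.Perm.mul_apply, adjSwap_left, adjSwap_right]; exact h1)
  rw [mul_assoc, Equiv.swap_mul_self, mul_one] at h2
  omega

theorem lt_of_adjacent_lt {γ : Type*} [Preorder γ] (f : Fin n → γ) (a b : ℕ)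
    (h : ∀ (i : ℕ) (hi : i + 1 < n), a ≤ i → i + 1 < b → f ⟨i, Nat.lt_of_succ_lt hi⟩ < f ⟨i + 1, hi⟩)
    {i j : Fin n} (hi : a ≤ i) (hij : i < j) (hj : (j : ℕ) < b) : f i < f j := by
  obtain ⟨j, hjn⟩ := j
  induction j with
  | zero => exact absurd hij (Nat.not_lt_zero _)
  | succ m ih =>
    have h1 := h m hjn (hi.trans (Nat.lt_succ_iff.1 hij)) hj
    rcases (Nat.lt_succ_iff.1 hij).lt_or_eq with h2 | h2
    · exact (ih (Nat.lt_of_succ_lt hjn) h2 (Nat.lt_of_succ_lt hj)).trans h1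
    · rwa [show i = ⟨m, Nat.lt_of_succ_lt hjn⟩ from Fin.ext h2]

theorem eq_revPerm_of_descents (u : Equiv.Perm (Fin n))
    (h : ∀ (i : ℕ) (hi : i + 1 < n), ¬ u ⟨i, Nat.lt_of_succ_lt hi⟩ < u ⟨i + 1, hi⟩) :
    u = Fin.revPerm := by
  have hmono : StrictMono fun i => Fin.rev (u i) := by
    intro i j hij
    refine lt_of_adjacent_lt (fun i => Fin.rev (u i)) 0 n (fun i hi _ _ => ?_) (Nat.zero_le _) hij j.2
    rw [Fin.rev_lt_rev]
    refine lt_of_le_of_ne (not_lt.1 (h i hi)) fun h => ?_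
    have := congrArg Fin.val (u.injective h)
    simp at this
  have h1 := (hmono.range_inj (strictMono_id (α := Fin n))).1 (by
    rw [Set.range_id, Set.range_eq_univ]
    exact Fin.rev_surjective.comp u.surjective)
  ext i
  have := congrFun h1 i
  rw [id, Fin.rev_eq_iff] at this
  rw [this]; rfl

theorem revPerm_not_lt (i : ℕ) (hi : i + 1 < n) :
    ¬ (Fin.revPerm : Equiv.Perm (Fin n)) ⟨i, Nat.lt_of_succ_lt hi⟩ < Fin.revPerm ⟨i + 1, hi⟩ := by
  simp [Fin.lt_def, Fin.val_rev]; omega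

/-- Induction on permutations from the longest one down. -/
theorem ascent_induction {p : Equiv.Perm (Fin n) → Prop}
    (H : ∀ u, (∀ v, invCount u < invCount v → p v) → p u) (u : Equiv.Perm (Fin n)) : p u := by
  have hle : ∀ u : Equiv.Perm (Fin n), invCount u ≤ n * n := fun u =>
    (Finset.card_le_univ _).trans (by simp)
  induction hm : n * n - invCount u using Nat.strong_induction_on generalizing u with
  | _ m ih =>
    refine H u fun v hv => ih _ ?_ v rfl
    have := hle v
    omega

theorem IsGrothendieck.of_ascent (u : Equiv.Perm (Fin n)) (i : ℕ) (hi : i + 1 < n) (f : RatField)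
    (h : u ⟨i, Nat.lt_of_succ_lt hi⟩ < u ⟨i + 1, hi⟩)
    (hf : IsGrothendieck (u * adjSwap i hi) f) : IsGrothendieck u (isobaric i f) :=
  .step u i hi f (invCount_mul_adjSwap u i hi h) hf

theorem IsGrothendieck.exists (u : Equiv.Perm (Fin n)) : ∃ f, IsGrothendieck u f := by
  induction u using ascent_induction with
  | _ u ih =>
    by_cases h : ∀ (i : ℕ) (hi : i + 1 < n),
      ¬ u ⟨i, Nat.lt_of_succ_lt hi⟩ < u ⟨i + 1, hi⟩
    · rw [eq_revPerm_of_descents u h]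
      exact ⟨_, .longest⟩
    · push Not at h
      obtain ⟨i, hi, h⟩ := h
      obtain ⟨f, hf⟩ := ih (u * adjSwap i hi) (by rw [invCount_mul_adjSwap u i hi h]; omega)
      exact ⟨_, .of_ascent u i hi f h hf⟩

end Permutations

/-! ### Isobaric divided differences and their braid relations -/

/-- The action of a permutation of the `α`'s on rational functions. -/
def permAlpha (σ : Equiv.Perm ℕ) : RatField ≃+* RatField :=
  IsFractionRing.ringEquivOfRingEquiv
    (MvPolynomial.renameEquiv ℤ (Equiv.sumCongr σ (Equiv.refl ℕ))).toRingEquiv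

theorem swapAlpha_eq (i : ℕ) : swapAlpha i = permAlpha (Equiv.swap i (i + 1)) := rfl

theorem permAlpha_algebraMap (σ : Equiv.Perm ℕ) (P : MvPolynomial (ℕ ⊕ ℕ) ℤ) :
    permAlpha σ (algebraMap _ RatField P) =
      algebraMap _ RatField (MvPolynomial.rename (Sum.map σ id) P) := by
  rw [permAlpha, IsFractionRing.ringEquivOfRingEquiv_algebraMap]
  rfl

@[simp] theorem permAlpha_alpha (σ : Equiv.Perm ℕ) (i : ℕ) :
    permAlpha σ (alpha i) = alpha (σ i) := by
  rw [alpha, permAlpha_algebraMap, MvPolynomial.rename_X]; rfl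

@[simp] theorem permAlpha_beta (σ : Equiv.Perm ℕ) (i : ℕ) :
    permAlpha σ (beta i) = beta i := by
  rw [beta, permAlpha_algebraMap, MvPolynomial.rename_X]; rfl

theorem permAlpha_mul (σ τ : Equiv.Perm ℕ) (f : RatField) :
    permAlpha (σ * τ) f = permAlpha σ (permAlpha τ f) := by
  have h : (permAlpha (σ * τ) : RatField →+* RatField) =
      (permAlpha σ : RatField →+* RatField).comp (permAlpha τ : RatField →+* RatField) := by
    refine IsLocalization.ringHom_ext (nonZeroDivisors (MvPolynomial (ℕ ⊕ ℕ) ℤ)) ?_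
    refine MvPolynomial.ringHom_ext (fun c => by simp) fun v => ?_
    · simp only [RingHom.comp_apply, RingHom.coe_coe, permAlpha_algebraMap, MvPolynomial.rename_X]
      rcases v with i | j <;> rfl
  exact RingHom.congr_fun h f

@[simp] theorem permAlpha_one (f : RatField) : permAlpha 1 f = f := by
  apply (permAlpha 1).injective
  rw [← permAlpha_mul, one_mul]

theorem alpha_sub_ne_zero {i j : ℕ} (h : i ≠ j) : alpha i - alpha j ≠ 0 :=
  sub_ne_zero.2 fun e => h (alpha_injective e)

theorem swapAlpha_alpha_left (i : ℕ) : swapAlpha i (alpha i) = alpha (i + 1) := by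
  rw [swapAlpha_eq, permAlpha_alpha, Equiv.swap_apply_left]

theorem swapAlpha_alpha_right (i : ℕ) : swapAlpha i (alpha (i + 1)) = alpha i := by
  rw [swapAlpha_eq, permAlpha_alpha, Equiv.swap_apply_right]

theorem swapAlpha_alpha_of_ne (i j : ℕ) (h1 : j ≠ i) (h2 : j ≠ i + 1) :
    swapAlpha i (alpha j) = alpha j := by
  rw [swapAlpha_eq, permAlpha_alpha, Equiv.swap_apply_of_ne_of_ne h1 h2]

theorem swapAlpha_beta (i j : ℕ) : swapAlpha i (beta j) = beta j := by
  rw [swapAlpha_eq, permAlpha_beta]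

theorem swapAlpha_swapAlpha (i : ℕ) (f : RatField) : swapAlpha i (swapAlpha i f) = f := by
  rw [swapAlpha_eq, ← permAlpha_mul, Equiv.swap_mul_self, permAlpha_one]

theorem swapAlpha_isobaric (i : ℕ) (f : RatField) :
    swapAlpha i (isobaric i f) = isobaric i f := by
  have h := alpha_sub_ne_zero (Nat.succ_ne_self i)
  have h' := alpha_sub_ne_zero (Nat.succ_ne_self i).symm
  rw [isobaric, map_div₀, map_sub, map_sub, map_mul, map_mul, swapAlpha_swapAlpha,
    swapAlpha_alpha_left, swapAlpha_alpha_right, div_eq_div_iff h h']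
  ring

theorem isobaric_mul_of_invariant (i : ℕ) (f g : RatField) (hg : swapAlpha i g = g) :
    isobaric i (g * f) = g * isobaric i f := by
  rw [isobaric, isobaric, map_mul, hg]; ring

theorem isobaric_comm (i j : ℕ) (h : i + 2 ≤ j) (f : RatField) :
    isobaric i (isobaric j f) = isobaric j (isobaric i f) := by
  have hc : swapAlpha i (swapAlpha j f) = swapAlpha j (swapAlpha i f) := by
    rw [swapAlpha_eq, swapAlpha_eq, ← permAlpha_mul, ← permAlpha_mul]
    congr 1
    refine congrArg _ (Equiv.ext fun x => ?_)
    simp only [Equiv.Perm.mul_apply, Equiv.swap_apply_def]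
    split_ifs <;> omega
  have h1 := alpha_sub_ne_zero (show i ≠ i + 1 by omega)
  have h2 := alpha_sub_ne_zero (show j ≠ j + 1 by omega)
  simp only [isobaric, map_div₀, map_sub, map_mul, hc]
  rw [swapAlpha_alpha_of_ne i j (by omega) (by omega),
    swapAlpha_alpha_of_ne i (j + 1) (by omega) (by omega),
    swapAlpha_alpha_of_ne j i (by omega) (by omega),
    swapAlpha_alpha_of_ne j (i + 1) (by omega) (by omega)]
  field_simp
  ring

theorem isobaric_braid (i : ℕ) (f : RatField) :
    isobaric i (isobaric (i + 1) (isobaric i f)) =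
      isobaric (i + 1) (isobaric i (isobaric (i + 1) f)) := by
  have hb : swapAlpha i (swapAlpha (i + 1) (swapAlpha i f)) =
      swapAlpha (i + 1) (swapAlpha i (swapAlpha (i + 1) f)) := by
    simp only [swapAlpha_eq, ← permAlpha_mul]
    congr 1
    refine congrArg _ (Equiv.ext fun x => ?_)
    simp only [Equiv.Perm.mul_apply, Equiv.swap_apply_def]
    split_ifs <;> omega
  have h1 := alpha_sub_ne_zero (show i ≠ i + 1 by omega)
  have h2 := alpha_sub_ne_zero (show i + 1 ≠ i + 1 + 1 by omega)
  have h3 := alpha_sub_ne_zero (show i ≠ i + 1 + 1 by omega)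
  have h1' := alpha_sub_ne_zero (show i + 1 ≠ i by omega)
  have h2' := alpha_sub_ne_zero (show i + 1 + 1 ≠ i + 1 by omega)
  simp only [isobaric, map_div₀, map_sub, map_mul, hb, swapAlpha_swapAlpha, swapAlpha_alpha_left,
    swapAlpha_alpha_right, swapAlpha_alpha_of_ne i (i + 1 + 1) (by omega) (by omega),
    swapAlpha_alpha_of_ne (i + 1) i (by omega) (by omega)]
  -- The six images of `f` under the symmetric group on three variables now count as independent
  -- unknowns, so a rational identity in `a, b, c` remains.
  generalize swapAlpha (i + 1) (swapAlpha i (swapAlpha (i + 1) f)) = f1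
  generalize swapAlpha (i + 1) (swapAlpha i f) = f2
  generalize swapAlpha i (swapAlpha (i + 1) f) = f3
  generalize swapAlpha i f = f4
  generalize swapAlpha (i + 1) f = f5
  generalize alpha i = a at *
  generalize alpha (i + 1) = b at *
  generalize alpha (i + 1 + 1) = c at *
  rw [← neg_sub a b] at *
  rw [← neg_sub b c] at *
  field_simp
  ring

/-! ### Independence of the chosen path -/

section Uniqueness

variable {n : ℕ}

theorem adjSwap_comm (i j : ℕ) (hi : i + 1 < n) (hj : j + 1 < n) (h : i + 2 ≤ j) :
    adjSwap i hi * adjSwap j hj = adjSwap j hj * adjSwap i hi := by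
  refine (Equiv.Perm.disjoint_swap_swap ?_).commute
  simp only [List.nodup_cons, List.mem_cons, Fin.ext_iff, List.not_mem_nil, or_false, not_or,
    List.nodup_nil, not_false_eq_true, and_true]
  omega

theorem adjSwap_braid (i : ℕ) (hi : i + 1 + 1 < n) :
    adjSwap i (by omega) * adjSwap (i + 1) hi * adjSwap i (by omega) =
      adjSwap (i + 1) hi * adjSwap i (by omega) * adjSwap (i + 1) hi := by
  have h1 : (⟨i, by omega⟩ : Fin n) ≠ ⟨i + 1, by omega⟩ := by simp
  have h2 : (⟨i, by omega⟩ : Fin n) ≠ ⟨i + 1 + 1, hi⟩ := by simp; omega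
  have h3 : (⟨i + 1, by omega⟩ : Fin n) ≠ ⟨i + 1 + 1, hi⟩ := by simp
  have e1 := Equiv.swap_mul_swap_mul_swap h3.symm h2.symm
  have e2 := Equiv.swap_mul_swap_mul_swap h1 h2
  rw [Equiv.swap_comm (⟨i + 1, _⟩ : Fin n) ⟨i, _⟩,
    Equiv.swap_comm (⟨i + 1 + 1, _⟩ : Fin n) ⟨i + 1, _⟩] at e1
  rw [adjSwap, adjSwap, e1, e2, Equiv.swap_comm]

/-- Two derivations ending with `π_i` and `π_j` are compared through a common longer permutation: `u
s_i s_j` when the indices are far apart, `u s_i s_j s_i` when they are adjacent. By induction its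
value determines both premises, and the operators satisfy the same relation as the transpositions.
-/
theorem IsGrothendieck.unique {u : Equiv.Perm (Fin n)} {f g : RatField} (hf : IsGrothendieck u f)
    (hg : IsGrothendieck u g) : f = g := by
  induction u using ascent_induction generalizing f g with
  | _ u ih =>
  have braid : ∀ (i : ℕ) (hi : i + 1 + 1 < n) (f' g' : RatField),
      u ⟨i, by omega⟩ < u ⟨i + 1, by omega⟩ → u ⟨i + 1, by omega⟩ < u ⟨i + 1 + 1, hi⟩ →
      IsGrothendieck (u * adjSwap i (by omega)) f' → IsGrothendieck (u * adjSwap (i + 1) hi) g' →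
      isobaric i f' = isobaric (i + 1) g' := by
    intro i hi f' g' h1 h2 hf' hg'
    have hs : i + 1 < n := by omega
    set s : Equiv.Perm (Fin n) := adjSwap i hs
    set t : Equiv.Perm (Fin n) := adjSwap (i + 1) hi
    have s0 : s ⟨i, by omega⟩ = ⟨i + 1, by omega⟩ := adjSwap_left i hs
    have s1 : s ⟨i + 1, by omega⟩ = ⟨i, by omega⟩ := adjSwap_right i hs
    have s2 : s ⟨i + 1 + 1, hi⟩ = ⟨i + 1 + 1, hi⟩ := adjSwap_of_ne i hs _ (by simp; omega) (by simp)
    have t0 : t ⟨i, by omega⟩ = ⟨i, by omega⟩ := adjSwap_of_ne _ hi _ (by simp) (by simp; omega)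
    have t1 : t ⟨i + 1, by omega⟩ = ⟨i + 1 + 1, hi⟩ := adjSwap_left _ hi
    have t2 : t ⟨i + 1 + 1, hi⟩ = ⟨i + 1, by omega⟩ := adjSwap_right _ hi
    have hst : u * s * t * s = u * t * s * t := by
      have hmul : s * t * s = t * s * t := adjSwap_braid i hi
      rw [mul_assoc u, mul_assoc u, hmul, mul_assoc u, mul_assoc u]
    obtain ⟨h, hh⟩ := IsGrothendieck.exists (u * s * t * s)
    have e1 : isobaric (i + 1) (isobaric i h) = f' := by
      refine (ih _ ?_ hf' ?_).symm
      · rw [invCount_mul_adjSwap u i hs h1]; omega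
      · refine .of_ascent _ (i + 1) hi _ ?_ (.of_ascent _ i hs _ ?_ hh)
        · simp only [Equiv.Perm.mul_apply, s1, s2]; exact h1.trans h2
        · change (u * s * t) _ < (u * s * t) _
          simp only [Equiv.Perm.mul_apply, t0, t1, s0, s2]; exact h2
    have e2 : isobaric i (isobaric (i + 1) h) = g' := by
      refine (ih _ ?_ hg' ?_).symm
      · rw [invCount_mul_adjSwap u _ hi h2]; omega
      · rw [hst] at hh
        refine .of_ascent _ i hs _ ?_ (.of_ascent _ (i + 1) hi _ ?_ hh)
        · simp only [Equiv.Perm.mul_apply, t0, t1]; exact h1.trans h2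
        · change (u * t * s) _ < (u * t * s) _
          simp only [Equiv.Perm.mul_apply, t0, t2, s1, s2]; exact h1
    rw [← e1, ← e2, isobaric_braid]
  have comm : ∀ (i j : ℕ) (hi : i + 1 < n) (hj : j + 1 < n) (f' g' : RatField), i + 2 ≤ j →
      u ⟨i, by omega⟩ < u ⟨i + 1, hi⟩ → u ⟨j, by omega⟩ < u ⟨j + 1, hj⟩ →
      IsGrothendieck (u * adjSwap i hi) f' → IsGrothendieck (u * adjSwap j hj) g' →
      isobaric i f' = isobaric j g' := by
    intro i j hi hj f' g' hij h1 h2 hf' hg'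
    have hst : u * adjSwap i hi * adjSwap j hj = u * adjSwap j hj * adjSwap i hi := by
      rw [mul_assoc, mul_assoc, adjSwap_comm i j hi hj hij]
    obtain ⟨h, hh⟩ := IsGrothendieck.exists (u * adjSwap i hi * adjSwap j hj)
    have e1 : isobaric j h = f' := by
      refine (ih _ ?_ hf' (.of_ascent _ j hj _ ?_ hh)).symm
      · rw [invCount_mul_adjSwap u i hi h1]; omega
      · rw [Equiv.Perm.mul_apply, Equiv.Perm.mul_apply,
          adjSwap_of_ne i hi _ (by simp; omega) (by simp; omega),
          adjSwap_of_ne i hi _ (by simp; omega) (by simp; omega)]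
        exact h2
    have e2 : isobaric i h = g' := by
      rw [hst] at hh
      refine (ih _ ?_ hg' (.of_ascent _ i hi _ ?_ hh)).symm
      · rw [invCount_mul_adjSwap u j hj h2]; omega
      · rw [Equiv.Perm.mul_apply, Equiv.Perm.mul_apply,
          adjSwap_of_ne j hj _ (by simp; omega) (by simp; omega),
          adjSwap_of_ne j hj _ (by simp; omega) (by simp; omega)]
        exact h1
    rw [← e1, ← e2, isobaric_comm i j hij]
  cases hf with
  | longest =>
    cases hg with
    | longest => rfl
    | step _ j hj g' hlen hg' =>
      exact absurd (lt_of_invCount_mul_adjSwap _ j hj hlen) (revPerm_not_lt j hj)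
  | step _ i hi f' hlen hf' =>
    have h1 := lt_of_invCount_mul_adjSwap _ i hi hlen
    cases hg with
    | longest => exact absurd h1 (revPerm_not_lt i hi)
    | step _ j hj g' hlen' hg' =>
      have h2 := lt_of_invCount_mul_adjSwap _ j hj hlen'
      rcases lt_trichotomy i j with hij | rfl | hij
      · rcases (Nat.succ_le_of_lt hij).eq_or_lt with e | e
        · obtain rfl : j = i + 1 := e.symm
          exact braid i hj f' g' h1 h2 hf' hg'
        · exact comm i j hi hj f' g' e h1 h2 hf' hg'
      · rw [ih _ (by rw [hlen]; omega) hf' hg']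
      · rcases (Nat.succ_le_of_lt hij).eq_or_lt with e | e
        · obtain rfl : i = j + 1 := e.symm
          exact (braid j hi g' f' h2 h1 hg' hf').symm
        · exact (comm j i hj hi g' f' e h2 h1 hg' hf').symm

end Uniqueness

/-! ### Product formula for dominant permutations -/

section Dominant

variable {n : ℕ}

theorem code_succ_of_lt (u : Equiv.Perm (Fin n)) (i : ℕ) (hi : i + 1 < n)
    (h : u ⟨i, Nat.lt_of_succ_lt hi⟩ < u ⟨i + 1, hi⟩) :
    code u ⟨i, Nat.lt_of_succ_lt hi⟩ ≤ code u ⟨i + 1, hi⟩ := by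
  refine Finset.card_le_card fun j hj => ?_
  rw [Finset.mem_filter] at hj ⊢
  obtain ⟨-, h1, h2⟩ := hj
  refine ⟨Finset.mem_univ _, lt_of_le_of_ne h1 ?_, h2.trans h⟩
  rintro rfl
  exact absurd (h.trans h2) (lt_irrefl _)

theorem code_succ_of_not_lt (u : Equiv.Perm (Fin n)) (i : ℕ) (hi : i + 1 < n)
    (h : ¬ u ⟨i, Nat.lt_of_succ_lt hi⟩ < u ⟨i + 1, hi⟩) :
    code u ⟨i + 1, hi⟩ < code u ⟨i, Nat.lt_of_succ_lt hi⟩ := by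
  have hlt : u ⟨i + 1, hi⟩ < u ⟨i, Nat.lt_of_succ_lt hi⟩ := by
    refine lt_of_le_of_ne (not_lt.1 h) fun h => ?_
    have := congrArg Fin.val (u.injective h)
    simp at this
  refine Finset.card_lt_card (Finset.ssubset_iff.2 ⟨⟨i + 1, hi⟩, by simp, fun j hj => ?_⟩)
  rw [Finset.mem_insert, Finset.mem_filter] at hj
  rw [Finset.mem_filter]
  rcases hj with rfl | ⟨-, h1, h2⟩
  · exact ⟨Finset.mem_univ _, Nat.lt_succ_self i, hlt⟩
  · exact ⟨Finset.mem_univ _, (Nat.lt_succ_self i).trans h1, h2.trans hlt⟩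

/-- The product of the `1 - β_j / α_i` over the diagram of the code. -/
def dominantValue (u : Equiv.Perm (Fin n)) : RatField :=
  ∏ i : Fin n, ∏ q ∈ Finset.range (code u i), (1 - beta q / alpha i)

theorem code_revPerm (i : Fin n) : code Fin.revPerm i = n - 1 - i := by
  have : (Finset.univ.filter fun j : Fin n => i < j ∧ Fin.revPerm j < Fin.revPerm i) =
      Finset.Ioi i := by
    ext j; simp
  rw [code, this, Fin.card_Ioi]

theorem dominantValue_revPerm : dominantValue (Fin.revPerm : Equiv.Perm (Fin n)) =
    longestValue n := by
  simp only [dominantValue, longestValue, code_revPerm]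
  rw [Fin.prod_univ_eq_prod_range
    (fun i => ∏ q ∈ Finset.range (n - 1 - i), (1 - beta q / alpha i)) n,
    Finset.prod_filter, Finset.prod_product_right]
  refine Finset.prod_congr rfl fun i hi => ?_
  rw [← Finset.prod_filter]
  refine Finset.prod_congr ?_ fun _ _ => rfl
  ext q
  simp only [Finset.mem_range, Finset.mem_filter] at *
  omega

theorem alpha_adjSwap (i : ℕ) (hi : i + 1 < n) (j : Fin n) :
    alpha (adjSwap i hi j) = swapAlpha i (alpha j) := by
  rw [swapAlpha_eq, permAlpha_alpha]
  congr 1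
  by_cases h1 : (j : ℕ) = i
  · obtain rfl : j = ⟨i, Nat.lt_of_succ_lt hi⟩ := Fin.ext h1
    rw [adjSwap_left, Equiv.swap_apply_left]
  · by_cases h2 : (j : ℕ) = i + 1
    · obtain rfl : j = ⟨i + 1, hi⟩ := Fin.ext h2
      rw [adjSwap_right, Equiv.swap_apply_right]
    · rw [adjSwap_of_ne _ _ _ h1 h2, Equiv.swap_apply_of_ne_of_ne h1 h2]

theorem isobaric_linear (i : ℕ) (b : RatField) (hb : swapAlpha i b = b) :
    isobaric i (1 - b / alpha i) = 1 := by
  have h := alpha_sub_ne_zero (Nat.succ_ne_self i).symm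
  have h1 := alpha_ne_zero i
  have h2 := alpha_ne_zero (i + 1)
  rw [isobaric, map_sub, map_one, map_div₀, hb, swapAlpha_alpha_left, div_eq_one_iff_eq h]
  field_simp
  ring

/-- At the first ascent `i` the two code entries agree, so the product for `u` is symmetric in `α_i,
α_{i+1}`. The product for `u s_i` has just one more linear factor, and `π_i` sends that factor to
`1`. -/
theorem IsGrothendieck.of_antitone_code (u : Equiv.Perm (Fin n)) (h : Antitone (code u)) :
    IsGrothendieck u (dominantValue u) := by
  induction u using ascent_induction with
  | _ u ih =>
  by_cases hd : ∀ (i : ℕ) (hi : i + 1 < n),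
      ¬ u ⟨i, Nat.lt_of_succ_lt hi⟩ < u ⟨i + 1, hi⟩
  · rw [eq_revPerm_of_descents u hd, dominantValue_revPerm]
    exact .longest
  push Not at hd
  classical
  obtain ⟨hi, hlt⟩ := Nat.find_spec hd
  have hmin := fun m hm => Nat.find_min hd (m := m) hm
  generalize Nat.find hd = i at hi hlt hmin
  have hcode : code u ⟨i, Nat.lt_of_succ_lt hi⟩ = code u ⟨i + 1, hi⟩ :=
    le_antisymm (code_succ_of_lt u i hi hlt) (h (Nat.le_succ i))
  have hswap : ∀ j, code u (adjSwap i hi j) = code u j := by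
    intro j
    by_cases h1 : (j : ℕ) = i
    · obtain rfl : j = ⟨i, Nat.lt_of_succ_lt hi⟩ := Fin.ext h1
      rw [adjSwap_left, hcode]
    · by_cases h2 : (j : ℕ) = i + 1
      · obtain rfl : j = ⟨i + 1, hi⟩ := Fin.ext h2
        rw [adjSwap_right, hcode]
      · rw [adjSwap_of_ne _ _ _ h1 h2]
  have hv : ∀ j, code (u * adjSwap i hi) j = code u j + if (j : ℕ) = i then 1 else 0 := by
    intro j
    rw [code_mul_adjSwap u i hi hlt, hswap]
  have hanti : Antitone (code (u * adjSwap i hi)) := by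
    intro j j' hjj'
    rw [hv, hv]
    have h0 := h hjj'
    by_cases e : (j' : ℕ) = i
    · by_cases e' : (j : ℕ) = i
      · rw [if_pos e, if_pos e']; omega
      · rw [if_pos e, if_neg e']
        have hji : (j : ℕ) < i := lt_of_le_of_ne (e ▸ hjj') e'
        obtain ⟨m, rfl⟩ : ∃ m, i = m + 1 := ⟨i - 1, by omega⟩
        -- As `i` is the first ascent, position `i - 1` is a descent, where the code drops strictly;
        -- this leaves room for the added `1`.
        have h1 := hmin m (Nat.lt_succ_self m)
        push Not at h1
        have h2 := code_succ_of_not_lt u m (by omega) (not_lt.2 (h1 (by omega)))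
        have h3 : code u ⟨m, by omega⟩ ≤ code u j := h (Nat.lt_succ_iff.1 hji)
        have h4 : j' = ⟨m + 1, by omega⟩ := Fin.ext e
        rw [h4]
        omega
    · rw [if_neg e]; omega
  have hval : dominantValue (u * adjSwap i hi) = dominantValue u *
      (1 - beta (code u ⟨i, Nat.lt_of_succ_lt hi⟩) / alpha i) := by
    have : ∀ j : Fin n, ∏ q ∈ Finset.range (code (u * adjSwap i hi) j), (1 - beta q / alpha j) =
        (∏ q ∈ Finset.range (code u j), (1 - beta q / alpha j)) *
          if j = ⟨i, Nat.lt_of_succ_lt hi⟩ then 1 - beta (code u j) / alpha j else 1 := by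
      intro j
      rw [hv]
      by_cases e : (j : ℕ) = i
      · rw [if_pos e, if_pos (Fin.ext e), Finset.prod_range_succ]
      · rw [if_neg e, if_neg fun h => e (congrArg Fin.val h), add_zero, mul_one]
    rw [dominantValue, Finset.prod_congr rfl fun j _ => this j, Finset.prod_mul_distrib,
      Finset.prod_ite_eq', if_pos (Finset.mem_univ _)]
    rfl
  have hinv : swapAlpha i (dominantValue u) = dominantValue u := by
    rw [dominantValue, map_prod, ← Equiv.prod_comp (adjSwap i hi)
      (fun j => ∏ q ∈ Finset.range (code u j), (1 - beta q / alpha j))]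
    refine Finset.prod_congr rfl fun j _ => ?_
    rw [map_prod, hswap]
    refine Finset.prod_congr rfl fun q _ => ?_
    rw [map_sub, map_one, map_div₀, swapAlpha_beta, alpha_adjSwap]
  have := IsGrothendieck.of_ascent u i hi _ hlt
    (ih _ (by rw [invCount_mul_adjSwap u i hi hlt]; omega) hanti)
  rwa [hval, isobaric_mul_of_invariant _ _ _ hinv, isobaric_linear _ _ (swapAlpha_beta _ _),
    mul_one] at this

end Dominant

/-! ### Antisymmetrization in the `α`'s -/

section Antisymmetrizer

/-- The signed sum over the permutations of `α_1, …, α_N`. -/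
def antisymmetrize (N : ℕ) (f : RatField) : RatField :=
  ∑ σ : Equiv.Perm (Fin N), Equiv.Perm.sign σ •
    permAlpha (Equiv.Perm.viaEmbeddingHom Fin.valEmbedding σ) f

theorem viaEmbeddingHom_apply (N : ℕ) (σ : Equiv.Perm (Fin N)) (i : Fin N) :
    Equiv.Perm.viaEmbeddingHom Fin.valEmbedding σ (i : ℕ) = σ i :=
  Equiv.Perm.viaEmbedding_apply σ Fin.valEmbedding i

theorem viaEmbeddingHom_adjSwap (N i : ℕ) (hi : i + 1 < N) :
    Equiv.Perm.viaEmbeddingHom Fin.valEmbedding (adjSwap (n := N) i hi) =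
      Equiv.swap i (i + 1) := by
  ext x
  by_cases hx : x < N
  · rw [show x = ((⟨x, hx⟩ : Fin N) : ℕ) from rfl, viaEmbeddingHom_apply]
    by_cases h1 : x = i
    · subst h1; rw [adjSwap_left]; simp
    · by_cases h2 : x = i + 1
      · subst h2; rw [adjSwap_right]; simp
      · rw [adjSwap_of_ne _ _ _ h1 h2, Equiv.swap_apply_of_ne_of_ne h1 h2]
  · rw [Equiv.swap_apply_of_ne_of_ne (by omega) (by omega)]
    refine Equiv.Perm.viaEmbedding_apply_of_notMem _ _ _ ?_
    rintro ⟨y, rfl⟩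
    exact hx y.2

theorem antisymmetrize_swapAlpha (N i : ℕ) (hi : i + 1 < N) (f : RatField) :
    antisymmetrize N (swapAlpha i f) = -antisymmetrize N f := by
  rw [antisymmetrize, antisymmetrize, ← Equiv.sum_comp (Equiv.mulRight (adjSwap i hi)),
    ← Finset.sum_neg_distrib]
  refine Finset.sum_congr rfl fun σ _ => ?_
  have h1 : Equiv.Perm.sign (adjSwap i hi) = -1 := Equiv.Perm.sign_swap (by simp)
  rw [Equiv.coe_mulRight, map_mul, map_mul, viaEmbeddingHom_adjSwap, swapAlpha_eq, ← permAlpha_mul,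
    mul_assoc, Equiv.swap_mul_self, mul_one, h1, mul_neg_one, Units.neg_smul]

theorem antisymmetrize_sub (N : ℕ) (f g : RatField) :
    antisymmetrize N (f - g) = antisymmetrize N f - antisymmetrize N g := by
  simp only [antisymmetrize, map_sub, smul_sub, Finset.sum_sub_distrib]

/-- Antisymmetrization changes sign under `s_i`, so it sends `f - s_i f` to twice its value at `f`.
-/
theorem antisymmetrize_eq_of_sub_eq (N i : ℕ) (hi : i + 1 < N) (f g : RatField)
    (h : f - swapAlpha i f = g - swapAlpha i g) : antisymmetrize N f = antisymmetrize N g := by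
  have h1 := congrArg (antisymmetrize N) h
  rw [antisymmetrize_sub, antisymmetrize_sub, antisymmetrize_swapAlpha N i hi,
    antisymmetrize_swapAlpha N i hi] at h1
  linear_combination h1 / 2

/-- The monomial `∏ α_i ^ (N - i)`. -/
def staircase (N : ℕ) : RatField := ∏ i : Fin N, alpha i ^ (N - 1 - (i : ℕ))

theorem swapAlpha_staircase (N i : ℕ) (hi : i + 1 < N) :
    swapAlpha i (staircase N) * alpha i = staircase N * alpha (i + 1) := by
  have h1 : swapAlpha i (staircase N) =
      ∏ j : Fin N, alpha j ^ (N - 1 - (adjSwap i hi j : ℕ)) := by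
    rw [staircase, map_prod, ← Equiv.prod_comp (adjSwap i hi)]
    refine Finset.prod_congr rfl fun j _ => ?_
    rw [map_pow, ← alpha_adjSwap i hi, Equiv.swap_apply_self]
  have h2 : ∀ m : Fin N, alpha m = ∏ j : Fin N, if j = m then alpha j else 1 := fun m => by
    rw [Finset.prod_ite_eq', if_pos (Finset.mem_univ _)]
  rw [h1, staircase, show alpha i = alpha ((⟨i, by omega⟩ : Fin N) : ℕ) from rfl,
    show alpha (i + 1) = alpha ((⟨i + 1, hi⟩ : Fin N) : ℕ) from rfl, h2 ⟨i, _⟩, h2 ⟨i + 1, _⟩,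
    ← Finset.prod_mul_distrib, ← Finset.prod_mul_distrib]
  refine Finset.prod_congr rfl fun j _ => ?_
  by_cases e1 : (j : ℕ) = i
  · obtain rfl : j = ⟨i, Nat.lt_of_succ_lt hi⟩ := Fin.ext e1
    rw [adjSwap_left, if_pos rfl, if_neg (by simp), mul_one, ← pow_succ]
    congr 1; simp only; omega
  · by_cases e2 : (j : ℕ) = i + 1
    · obtain rfl : j = ⟨i + 1, hi⟩ := Fin.ext e2
      rw [adjSwap_right, if_pos rfl, if_neg (by simp), mul_one, ← pow_succ]
      congr 1; simp only; omega
    · rw [adjSwap_of_ne _ _ _ e1 e2, if_neg fun h => e1 (congrArg Fin.val h),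
        if_neg fun h => e2 (congrArg Fin.val h)]

/-- The staircase monomial is multiplied by `α_{i+1} / α_i` under `s_i`, and `π_i f` is symmetric.
Both arguments thus have the same `s_i`-antisymmetric part, `(α_i f - α_{i+1} s_i f) / α_i` times
the staircase. -/
theorem antisymmetrize_isobaric (N i : ℕ) (hi : i + 1 < N) (f : RatField) :
    antisymmetrize N (staircase N * isobaric i f) = antisymmetrize N (staircase N * f) := by
  refine antisymmetrize_eq_of_sub_eq N i hi _ _ ?_
  have h := alpha_sub_ne_zero (Nat.succ_ne_self i).symm
  have h1 := alpha_ne_zero i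
  have hs : swapAlpha i (staircase N) = staircase N * alpha (i + 1) / alpha i := by
    rw [eq_div_iff h1, swapAlpha_staircase N i hi]
  rw [map_mul, map_mul, swapAlpha_isobaric, hs, isobaric]
  field_simp

theorem permAlpha_of_invariant (N : ℕ) (f : RatField)
    (h : ∀ i, i + 1 < N → swapAlpha i f = f) (σ : Equiv.Perm (Fin N)) :
    permAlpha (Equiv.Perm.viaEmbeddingHom Fin.valEmbedding σ) f = f := by
  cases N with
  | zero => rw [Subsingleton.elim σ 1, map_one, permAlpha_one]
  | succ m =>
    have hσ : σ ∈ Submonoid.closure (Set.range fun i : Fin m => Equiv.swap i.castSucc i.succ) := by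
      rw [Equiv.Perm.mclosure_swap_castSucc_succ]; exact Submonoid.mem_top _
    induction hσ using Submonoid.closure_induction with
    | mem x hx =>
      obtain ⟨i, rfl⟩ := hx
      have := viaEmbeddingHom_adjSwap (m + 1) i (by omega)
      change permAlpha (Equiv.Perm.viaEmbeddingHom Fin.valEmbedding
        (adjSwap (n := m + 1) i (by omega))) f = f
      rw [this, ← swapAlpha_eq, h i (by omega)]
    | one => rw [map_one, permAlpha_one]
    | mul x y _ _ hx hy => rw [map_mul, permAlpha_mul, hy, hx]

theorem antisymmetrize_mul_of_invariant (N : ℕ) (f g : RatField)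
    (h : ∀ i, i + 1 < N → swapAlpha i f = f) :
    antisymmetrize N (g * f) = antisymmetrize N g * f := by
  rw [antisymmetrize, antisymmetrize, Finset.sum_mul]
  refine Finset.sum_congr rfl fun σ _ => ?_
  rw [map_mul, permAlpha_of_invariant N f h, smul_mul_assoc]

theorem antisymmetrize_prod (N : ℕ) (g : ℕ → RatField → RatField)
    (hg : ∀ σ i f, permAlpha σ (g i f) = g i (permAlpha σ f)) :
    antisymmetrize N (∏ i : Fin N, g i (alpha i)) =
      Matrix.det (Matrix.of fun k i : Fin N => g i (alpha k)) := by
  rw [antisymmetrize, Matrix.det_apply]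
  refine Finset.sum_congr rfl fun σ _ => ?_
  congr 1
  rw [map_prod]
  refine Finset.prod_congr rfl fun i _ => ?_
  rw [hg, permAlpha_alpha, viaEmbeddingHom_apply]; rfl

end Antisymmetrizer

/-! ### Quotient of determinants for Grassmannian permutations -/

section Grassmannian

variable {n : ℕ}

/-- Sorting the first `N` values into decreasing order leads to a dominant permutation without
changing the antisymmetrization against the staircase. Since the function of `w` itself is symmetric
in `α_1, …, α_N`, it factors out, and the remaining signed sums are determinants. -/
theorem IsGrothendieck.det_mul_eq {N : ℕ} (hN : N ≤ n) (w : Equiv.Perm (Fin n))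
    (hlow : ∀ (i : ℕ) (hi : i + 1 < n), i + 1 < N →
      w ⟨i, Nat.lt_of_succ_lt hi⟩ < w ⟨i + 1, hi⟩)
    (hhigh : ∀ (i : ℕ) (hi : i + 1 < n), N ≤ i → w ⟨i, Nat.lt_of_succ_lt hi⟩ < w ⟨i + 1, hi⟩)
    (c : ℕ → ℕ) (hc : ∀ (i : ℕ) (hi : i < N), (w ⟨N - 1 - i, by omega⟩ : ℕ) = c i)
    {f : RatField} (hf : IsGrothendieck w f) :
    Matrix.det (Matrix.of fun k i : Fin N => alpha k ^ (N - 1 - (i : ℕ))) * f =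
      Matrix.det (Matrix.of fun k i : Fin N => alpha k ^ (N - 1 - (i : ℕ)) *
        ∏ q ∈ Finset.range (c i), (1 - beta q / alpha k)) := by
  have key : ∀ u : Equiv.Perm (Fin n), (∀ i : Fin n, N ≤ i → u i = w i) → ∀ g,
      IsGrothendieck u g → antisymmetrize N (staircase N * g) =
        antisymmetrize N (∏ i : Fin N, (alpha i ^ (N - 1 - (i : ℕ)) *
          ∏ q ∈ Finset.range (c i), (1 - beta q / alpha i))) := by
    intro u
    induction u using ascent_induction with
    | _ u ih =>
    intro hu g hg
    by_cases hd : ∀ (i : ℕ) (hi : i + 1 < n), i + 1 < N →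
      ¬ u ⟨i, Nat.lt_of_succ_lt hi⟩ < u ⟨i + 1, hi⟩
    · have hanti : ∀ {i j : Fin n}, i < j → (j : ℕ) < N → u j < u i := by
        intro i j hij hj
        rw [← Fin.rev_lt_rev]
        refine lt_of_adjacent_lt (fun i => Fin.rev (u i)) 0 N (fun i hi _ hiN => ?_)
          (Nat.zero_le _) hij hj
        rw [Fin.rev_lt_rev]
        refine lt_of_le_of_ne (not_lt.1 (hd i hi hiN)) fun h => ?_
        have := congrArg Fin.val (u.injective h)
        simp at this
      have hval : ∀ i : Fin n, (i : ℕ) < N → (u i : ℕ) = c i := by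
        have h1 : StrictMono fun i : Fin N => u (Fin.castLE hN (Fin.rev i)) := fun i j hij =>
          hanti (by simpa [Fin.lt_def] using Fin.rev_lt_rev.2 hij) (by simp; omega)
        have h2 : StrictMono fun i : Fin N => w (Fin.castLE hN i) := fun i j hij =>
          lt_of_adjacent_lt w 0 N (fun i hi _ hiN => hlow i hi hiN) (Nat.zero_le _) hij j.2
        -- Agreement with `w` from position `N` on forces the first `N` values of `u` and `w` to
        -- form the same set, and strictly monotone enumerations of a set coincide.
        have h3 := (h1.range_inj h2).1 (by
          ext x
          constructor
          · rintro ⟨i, rfl⟩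
            have hlt : ((w.symm (u (Fin.castLE hN (Fin.rev i))) : Fin n) : ℕ) < N := by
              by_contra hge
              have := hu _ (not_lt.1 hge)
              rw [Equiv.apply_symm_apply] at this
              have h4 := congrArg Fin.val (u.injective this)
              have h6 : ((Fin.castLE hN (Fin.rev i) : Fin n) : ℕ) < N := (Fin.rev i).2
              omega
            exact ⟨⟨_, hlt⟩, by simp [Fin.castLE]⟩
          · rintro ⟨i, rfl⟩
            have hlt : ((u.symm (w (Fin.castLE hN i)) : Fin n) : ℕ) < N := by
              by_contra hge
              have := hu _ (not_lt.1 hge)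
              rw [Equiv.apply_symm_apply] at this
              have h4 := congrArg Fin.val (w.injective this)
              have h6 : ((Fin.castLE hN i : Fin n) : ℕ) < N := i.2
              omega
            exact ⟨Fin.rev ⟨_, hlt⟩, by simp [Fin.castLE]⟩)
        intro i hi
        have h4 := congrFun h3 (Fin.rev ⟨i, hi⟩)
        rw [Fin.rev_rev] at h4
        rw [← hc i hi]
        have h5 : (Fin.castLE hN (Fin.rev ⟨i, hi⟩)) = ⟨N - 1 - i, by omega⟩ := by
          ext; simp [Fin.val_rev]; omega
        rw [h5] at h4
        exact congrArg Fin.val h4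
      -- The first `N` values decrease, so every value below `u i` lies to the right of `i`, and the
      -- code entry is the value itself; the remaining values increase and have no inversions.
      have hcode : ∀ i : Fin n, code u i = if (i : ℕ) < N then c i else 0 := by
        intro i
        split_ifs with hi
        · rw [← hval i hi, code]
          rw [← Fin.card_Iio (u i)]
          refine Finset.card_equiv u fun j => ?_
          rw [Finset.mem_filter, Finset.mem_Iio]
          refine ⟨fun h => h.2.2, fun h => ⟨Finset.mem_univ _, ?_, h⟩⟩
          by_contra hij
          rcases (not_lt.1 hij).eq_or_lt with e | e
          · rw [e] at h; exact lt_irrefl _ h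
          · exact lt_irrefl _ (h.trans (hanti e hi))
        · rw [code, Finset.card_eq_zero, Finset.filter_eq_empty_iff]
          rintro j - ⟨h1, h2⟩
          have hj : N ≤ j := (not_lt.1 hi).trans (le_of_lt h1)
          rw [hu i (not_lt.1 hi), hu j hj] at h2
          exact lt_irrefl _ (h2.trans (lt_of_adjacent_lt w N n (fun i hi h _ => hhigh i hi h)
            (not_lt.1 hi) h1 j.2))
      have hcanti : Antitone (code u) := by
        intro i j hij
        rw [hcode j]
        split_ifs with hj
        · have hi : (i : ℕ) < N := lt_of_le_of_lt hij hj
          rw [hcode i, if_pos hi, ← hval i hi, ← hval j hj]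
          rcases hij.eq_or_lt with e | e
          · rw [e]
          · exact (hanti e hj).le
        · exact Nat.zero_le _
      rw [hg.unique (.of_antitone_code u hcanti), staircase, dominantValue, Finset.prod_mul_distrib]
      congr 2
      simp only [hcode]
      rw [Fin.prod_univ_eq_prod_range (fun i => ∏ q ∈ Finset.range (if i < N then c i else 0),
          (1 - beta q / alpha i)) n, Fin.prod_univ_eq_prod_range
          (fun i => ∏ q ∈ Finset.range (c i), (1 - beta q / alpha i)) N,
        ← Finset.prod_subset (Finset.range_subset_range.2 hN)]
      · refine Finset.prod_congr rfl fun i hi => ?_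
        rw [if_pos (Finset.mem_range.1 hi)]
      · intro i _ hi
        rw [if_neg (fun h => hi (Finset.mem_range.2 h)), Finset.prod_range_zero]
    · push Not at hd
      obtain ⟨i, hi, hiN, hlt⟩ := hd
      obtain ⟨g', hg'⟩ := IsGrothendieck.exists (u * adjSwap i hi)
      rw [hg.unique (.of_ascent u i hi _ hlt hg'), antisymmetrize_isobaric N i hiN]
      refine ih _ (by rw [invCount_mul_adjSwap u i hi hlt]; omega) (fun j hj => ?_) g' hg'
      rw [Equiv.Perm.mul_apply, adjSwap_of_ne _ _ _ (by omega) (by omega), hu j hj]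
  have hinv : ∀ i, i + 1 < N → swapAlpha i f = f := by
    intro i hi
    obtain ⟨g, hg⟩ := IsGrothendieck.exists (w * adjSwap i (by omega))
    rw [hf.unique (.of_ascent w i (by omega) g (hlow i (by omega) hi) hg), swapAlpha_isobaric]
  have h := key w (fun _ _ => rfl) f hf
  rw [antisymmetrize_mul_of_invariant N f _ hinv, staircase,
    antisymmetrize_prod N (fun i x => x ^ (N - 1 - i)) (fun σ i f => map_pow _ _ _),
    antisymmetrize_prod N (fun i x => x ^ (N - 1 - i) *
      ∏ q ∈ Finset.range (c i), (1 - beta q / x)) (fun σ i f => by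
        simp [map_mul, map_prod])] at h
  exact h

end Grassmannian

/-! ### From the quotient to a residue determinant -/

section PartialFractions

variable {K : Type*} [Field K]

/-- By the residue theorem the sum of the residues at `0` and `∞` is minus the sum at the simple
poles `1 / α_s`. Only the existence of coefficients `A s` independent of `b` is needed, and it
follows by solving a first-order recurrence in `b` when a pole is added. -/
theorem exists_resSum_eq_sum (N : ℕ) (α β : ℕ → K) (hα : ∀ s, α s ≠ 0)
    (hinj : Function.Injective α) :
    ∃ A : ℕ → K, ∀ b, resSum N 0 0 b α β = ∑ s ∈ Finset.range N, A s * (α s)⁻¹ ^ b := by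
  induction N with
  | zero =>
    refine ⟨0, fun b => ?_⟩
    have h : ∀ m : ℤ, intCoeff (1 : PowerSeries K) m = if m = 0 then 1 else 0 := by
      intro m
      rcases lt_or_ge m 0 with hm | hm
      · rw [intCoeff_of_neg _ hm, if_neg (by omega)]
      · lift m to ℕ using hm
        rw [intCoeff_natCast, PowerSeries.coeff_one]; simp
    simp [resSum, seriesZero, seriesInfty, numerZero, h]
  | succ N ih =>
    obtain ⟨A, hA⟩ := ih
    -- These coefficients give a particular solution of the recurrence in `b`; the difference `D`
    -- solves the homogeneous one and is geometric.
    set A' : ℕ → K := fun s => A s / (1 - α N * (α s)⁻¹) with hA'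
    set D : ℤ → K := fun b => resSum (N + 1) 0 0 b α β -
      ∑ s ∈ Finset.range N, A' s * (α s)⁻¹ ^ b with hD
    have hrec : ∀ b, D (b + 1) = D b * (α N)⁻¹ := by
      intro b
      have h1 := resSum_denom_succ N 0 0 b α β (hα N)
      have h2 : ∑ s ∈ Finset.range N, A' s * (α s)⁻¹ ^ b -
          α N * ∑ s ∈ Finset.range N, A' s * (α s)⁻¹ ^ (b + 1) =
            ∑ s ∈ Finset.range N, A s * (α s)⁻¹ ^ b := by
        rw [Finset.mul_sum, ← Finset.sum_sub_distrib]
        refine Finset.sum_congr rfl fun s hs => ?_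
        have hne : 1 - α N * (α s)⁻¹ ≠ 0 := by
          rw [sub_ne_zero, ← div_eq_mul_inv]
          intro h
          rw [eq_comm, div_eq_one_iff_eq (hα s)] at h
          have := hinj h
          rw [Finset.mem_range] at hs
          omega
        rw [hA', zpow_add_one₀ (inv_ne_zero (hα s))]
        simp only
        rw [div_mul_eq_mul_div, div_mul_eq_mul_div, mul_div_assoc', ← sub_div, div_eq_iff hne]
        ring
      rw [eq_mul_inv_iff_mul_eq₀ (hα N), hD]
      simp only
      rw [hA] at h1
      linear_combination -h1 + h2
    have hsol : ∀ b : ℤ, D b = D 0 * (α N)⁻¹ ^ b := by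
      intro b
      induction b using Int.induction_on with
      | zero => simp
      | succ b ih => rw [hrec, ih, zpow_add_one₀ (inv_ne_zero (hα N))]; ring
      | pred b ih =>
        have h := hrec (-b - 1)
        rw [sub_add_cancel, ih] at h
        rw [zpow_sub_one₀ (inv_ne_zero (hα N)), ← mul_assoc, h, inv_inv, mul_assoc,
          inv_mul_cancel₀ (hα N), mul_one]
    refine ⟨Function.update A' N (D 0), fun b => ?_⟩
    rw [Finset.sum_range_succ, Function.update_self, ← hsol, Finset.sum_congr rfl fun s hs => by
      rw [Function.update_of_ne (ne_of_lt (Finset.mem_range.1 hs))]]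
    simp [hD]

theorem resSum_eq_sum (N : ℕ) (α β A : ℕ → K) (hα : ∀ s, α s ≠ 0)
    (hA : ∀ b, resSum N 0 0 b α β = ∑ s ∈ Finset.range N, A s * (α s)⁻¹ ^ b) (l : ℕ) (b : ℤ) :
    resSum N l 0 b α β = ∑ s ∈ Finset.range N, A s * (α s)⁻¹ ^ b *
      ∏ q ∈ Finset.range l, (1 - β q / α s) := by
  induction l generalizing b with
  | zero => simpa using hA b
  | succ l ih =>
    rw [resSum_numer_succ, ih, ih, Finset.mul_sum, ← Finset.sum_sub_distrib]
    refine Finset.sum_congr rfl fun s _ => ?_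
    rw [Finset.prod_range_succ, zpow_add_one₀ (inv_ne_zero (hα s))]
    ring

/-- The residue matrix factors as `B` times the matrix in the numerator of the quotient, up to row
scaling. `B` is the same for every `c`, and `c = 0` shows that its determinant inverts the
denominator, so the coefficients `A s` never have to be computed. -/
theorem det_resSum_eq (N : ℕ) (α β : ℕ → K) (hα : ∀ s, α s ≠ 0) (hinj : Function.Injective α)
    (c : ℕ → ℕ) (f : K)
    (hf : Matrix.det (Matrix.of fun k i : Fin N => α k ^ (N - 1 - (i : ℕ))) * f =
      Matrix.det (Matrix.of fun k i : Fin N => α k ^ (N - 1 - (i : ℕ)) *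
        ∏ q ∈ Finset.range (c i), (1 - β q / α k))) :
    f = Matrix.det (Matrix.of fun i j : Fin N =>
      resSum N (c j) 0 (((j : ℕ) : ℤ) - (i : ℕ)) α β) := by
  obtain ⟨A, hA⟩ := exists_resSum_eq_sum N α β hα hinj
  set B : Matrix (Fin N) (Fin N) K := Matrix.of fun i s => A s * α s ^ (i : ℕ)
  have hprod : ∀ c : ℕ → ℕ, Matrix.of (fun i j : Fin N =>
      resSum N (c j) 0 (((j : ℕ) : ℤ) - (i : ℕ)) α β) = B * Matrix.of fun k i : Fin N =>
        (α k)⁻¹ ^ (i : ℕ) * ∏ q ∈ Finset.range (c i), (1 - β q / α k) := by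
    intro c
    ext i j
    rw [Matrix.mul_apply, Matrix.of_apply, resSum_eq_sum N α β A hα hA,
      ← Fin.sum_univ_eq_sum_range (fun s => A s * (α s)⁻¹ ^ (((j : ℕ) : ℤ) - (i : ℕ)) *
      ∏ q ∈ Finset.range (c j), (1 - β q / α s))]
    refine Finset.sum_congr rfl fun s _ => ?_
    simp only [B, Matrix.of_apply]
    rw [zpow_sub₀ (inv_ne_zero (hα s)), zpow_natCast, zpow_natCast, inv_pow, inv_pow, div_inv_eq_mul]
    ring
  have hone : Matrix.det (Matrix.of (fun i j : Fin N =>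
      resSum N 0 0 (((j : ℕ) : ℤ) - (i : ℕ)) α β)) = 1 := by
    rw [Matrix.det_of_isLowerTriangular]
    · refine Finset.prod_eq_one fun i _ => ?_
      rw [Matrix.of_apply, resSum_of_neg _ _ _ _ _ _ (by omega) (by omega), if_pos (by omega)]
    · intro i j h
      have h' : (i : ℕ) < j := h
      rw [Matrix.of_apply, resSum_of_neg _ _ _ _ _ _ (by omega) (by omega), if_neg (by omega)]
  have hscale : ∀ c : ℕ → ℕ, Matrix.det (Matrix.of fun k i : Fin N => α k ^ (N - 1 - (i : ℕ)) *
      ∏ q ∈ Finset.range (c i), (1 - β q / α k)) = (∏ k : Fin N, α k ^ (N - 1)) *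
        Matrix.det (Matrix.of fun k i : Fin N =>
        (α k)⁻¹ ^ (i : ℕ) * ∏ q ∈ Finset.range (c i), (1 - β q / α k)) := by
    intro c
    rw [← Matrix.det_mul_column]
    congr 1
    ext k i
    simp only [Matrix.of_apply]
    rw [pow_sub₀ _ (hα k) (by omega), inv_pow]
    ring
  have hne : ∏ k : Fin N, α k ^ (N - 1) ≠ 0 :=
    Finset.prod_ne_zero_iff.2 fun k _ => pow_ne_zero _ (hα k)
  have h0 := hscale fun _ => 0
  have h1 := hprod fun _ => 0
  simp only [Finset.range_zero, Finset.prod_empty, mul_one] at h0 h1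
  rw [h0, hscale, mul_assoc, mul_right_inj' hne] at hf
  rw [hprod, Matrix.det_mul, ← hf, ← mul_assoc, ← Matrix.det_mul, ← h1, hone, one_mul]

end PartialFractions

/-! ### Stable limits for partitions -/

section Stable

variable {n : ℕ}

theorem shiftPerm_castAdd (m : ℕ) (w : Equiv.Perm (Fin n)) (i : Fin m) :
    shiftPerm m w (Fin.castAdd n i) = Fin.castAdd n i := by
  simp [shiftPerm]

theorem shiftPerm_natAdd (m : ℕ) (w : Equiv.Perm (Fin n)) (i : Fin n) :
    shiftPerm m w (Fin.natAdd m i) = Fin.natAdd m (w i) := by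
  simp [shiftPerm]

theorem shiftPerm_of_lt (m : ℕ) (w : Equiv.Perm (Fin n)) (i : ℕ) (hi : i < m + n) (h : i < m) :
    (shiftPerm m w ⟨i, hi⟩ : ℕ) = i := by
  have := congrArg Fin.val (shiftPerm_castAdd m w ⟨i, h⟩)
  exact this

theorem shiftPerm_of_le (m : ℕ) (w : Equiv.Perm (Fin n)) (i : ℕ) (hi : i < m + n) (h : m ≤ i) :
    (shiftPerm m w ⟨i, hi⟩ : ℕ) = m + w ⟨i - m, by omega⟩ := by
  have := congrArg Fin.val (shiftPerm_natAdd m w ⟨i - m, by omega⟩)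
  have e : (Fin.natAdd m (⟨i - m, by omega⟩ : Fin n)) = ⟨i, hi⟩ := Fin.ext (by simp; omega)
  rw [e] at this
  exact this

theorem IsGrassmannian.shiftPerm {lam : List ℤ} {p : ℕ} {w : Equiv.Perm (Fin n)}
    (hw : IsGrassmannian lam p w) (m : ℕ) :
    IsGrassmannian lam (m + p) (StableGrothendieck.shiftPerm m w) where
  p_le := Nat.add_le_add_left hw.p_le m
  length_le j hj := hw.length_le j (by omega)
  apply_lt i hi := by
    obtain ⟨i, hin⟩ := i
    rcases lt_or_ge i m with h | h
    · rw [shiftPerm_of_lt m w i hin h]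
      simp only
      rw [hw.length_le _ (by omega), add_zero]
    · rw [shiftPerm_of_le m w i hin h]
      simp only at hi
      have h1 := hw.apply_lt ⟨i - m, by omega⟩ (by simp only; omega)
      simp only at h1 ⊢
      rw [Nat.cast_add, h1, show m + p - 1 - i = p - 1 - (i - m) by omega, Nat.cast_sub h]
      ring
  increasing i hi hip := by
    rw [Fin.lt_def]
    rcases lt_or_ge i m with h | h
    · rw [shiftPerm_of_lt m w i (by omega) h]
      rcases lt_or_ge (i + 1) m with h' | h'
      · rw [shiftPerm_of_lt m w _ hi h']; omega
      · rw [shiftPerm_of_le m w _ hi h']; omega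
    · rw [shiftPerm_of_le m w i (by omega) h, shiftPerm_of_le m w _ hi (by omega)]
      have h1 := hw.increasing (i - m) (by omega) (by omega)
      rw [Fin.lt_def] at h1
      simp only [show i + 1 - m = i - m + 1 by omega]
      omega

theorem IsPartition.getD_nonneg {lam : List ℤ} (h : IsPartition lam) (j : ℕ) :
    0 ≤ lam.getD j 0 := by
  rcases lt_or_ge j lam.length with hj | hj
  · rw [List.getD_eq_getElem _ _ hj]
    exact h.2 _ (List.getElem_mem hj)
  · rw [List.getD_eq_default _ _ hj]

/-- The number of `β`'s in column `j` is the value of `w` at the matching position. With it the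
exponent `a + k - l` of `1 - z` is zero, which is the case covered by partial fractions. -/
theorem IsGrothendieck.eq_resDet {lam : List ℤ} {p : ℕ} {w : Equiv.Perm (Fin n)}
    (hlam : IsPartition lam) (hw : IsGrassmannian lam p w) {f : RatField}
    (hf : IsGrothendieck w f) :
    f = resDet p (fun j => (lam.getD j 0 + p - (j + 1)).toNat) alpha beta p
      (fun j => lam.getD j 0) := by
  set c : ℕ → ℕ := fun j => (lam.getD j 0 + p - (j + 1)).toNat with hc
  have hcast : ∀ j < p, (c j : ℤ) = lam.getD j 0 + p - (j + 1) := fun j hj => by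
    have := hlam.getD_nonneg j
    simp only [hc]; omega
  have h1 := IsGrothendieck.det_mul_eq hw.p_le w (fun i hi hip => hw.increasing i hi (by omega))
    (fun i hi hip => hw.increasing i hi (by omega)) c (fun i hi => by
      have h2 := hw.apply_lt ⟨p - 1 - i, by have := hw.p_le; omega⟩ (by simp only; omega)
      simp only [show p - 1 - (p - 1 - i) = i by omega] at h2
      have h3 := hcast i hi
      omega) hf
  rw [det_resSum_eq p alpha beta alpha_ne_zero alpha_injective c f h1, resDet, shiftDet]
  congr 1
  ext i j
  rw [Matrix.of_apply, Matrix.of_apply, resCoeff, hcast j j.2]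
  congr 1
  ring

/-- Each of the first `lam.length` columns contains at least `m + p - lam.length` of the `β`'s, and
trailing zeros of the partition do not affect the determinant. Hence the stated bound on `m` makes
the coefficient stable. -/
theorem coeff_eq_of_isGrothendieck {lam : List ℤ} {p : ℕ} {w : Equiv.Perm (Fin n)}
    (hlam : IsPartition lam) (hw : IsGrassmannian lam p w) (d : (ℕ ⊕ ℕ) →₀ ℕ) (m : ℕ)
    (hm : varBound d + lam.length ≤ m) :
    ∃ P, (∀ f, IsGrothendieck (shiftPerm m w) f → IsRewrittenAs f P) ∧
      MvPolynomial.coeff d P =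
        MvPowerSeries.coeff d (resSeries lam.length fun j => lam.getD j 0) := by
  refine ⟨resPoly (m + p) (fun j => (lam.getD j 0 + (m + p : ℕ) - (j + 1)).toNat) lam.length
    (fun j => lam.getD j 0), fun f hf => ?_, ?_⟩
  · rw [hf.eq_resDet hlam (hw.shiftPerm m), resDet_extend _ _ _ _ (r := lam.length) _ (by omega)
      (fun j hj => (List.getD_eq_default _ _ hj).le)]
    exact isRewrittenAs_resPoly _ _ _ _
  · refine coeff_resPoly d _ _ _ _ (by omega) fun j hj => ?_
    have := hlam.getD_nonneg j
    omega

theorem isStableLimit_iff {lam : List ℤ} {p : ℕ} {w : Equiv.Perm (Fin n)}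
    (hlam : IsPartition lam) (hw : IsGrassmannian lam p w) (G : MvPowerSeries (ℕ ⊕ ℕ) ℤ) :
    IsStableLimit w G ↔ G = resSeries lam.length fun j => lam.getD j 0 := by
  constructor
  · intro h
    ext d
    obtain ⟨m, ⟨f, P, hf, hP, hc⟩, hm⟩ :=
      ((h d).and (eventually_ge_atTop (varBound d + lam.length))).exists
    obtain ⟨Q, hQ, hcQ⟩ := coeff_eq_of_isGrothendieck hlam hw d m hm
    rw [← hc, ← hcQ, hP.unique (hQ f hf)]
  · rintro rfl d
    filter_upwards [eventually_ge_atTop (varBound d + lam.length)] with m hm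
    obtain ⟨Q, hQ, hcQ⟩ := coeff_eq_of_isGrothendieck hlam hw d m hm
    obtain ⟨f, hf⟩ := IsGrothendieck.exists (shiftPerm m w)
    exact ⟨f, Q, hf, hQ f hf, hcQ⟩

end Stable

/-! ### Values on integer sequences -/

/-- The value of the double stable Grothendieck polynomial of an integer sequence. -/
def listSeries (I : List ℤ) : MvPowerSeries (ℕ ⊕ ℕ) ℤ :=
  resSeries I.length fun j => I.getD j 0

theorem getD_append_pair (I J : List ℤ) (p q p' q' : ℤ) :
    (fun j => (I ++ [p', q'] ++ J).getD j 0) =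
      Function.update (Function.update (fun j => (I ++ [p, q] ++ J).getD j 0) I.length p')
        (I.length + 1) q' := by
  funext j
  simp only [Function.update_apply, List.getD_eq_getElem?_getD]
  rcases lt_trichotomy j I.length with h | rfl | h
  · rw [if_neg (by omega), if_neg (by omega), List.append_assoc, List.append_assoc,
      List.getElem?_append_left h, List.getElem?_append_left h]
  · simp
  · obtain ⟨m, rfl⟩ : ∃ m, j = I.length + 1 + m := ⟨j - I.length - 1, by omega⟩
    cases m with
    | zero => simp
    | succ m =>
      have hJ : ∀ x y : ℤ, (I ++ [x, y] ++ J)[I.length + 1 + (m + 1)]? = J[m]? := by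
        intro x y
        rw [List.append_assoc, List.getElem?_append_right (by omega),
          show I.length + 1 + (m + 1) - I.length = m + 2 by omega]
        simp
      rw [if_neg (by omega), if_neg (by omega), hJ, hJ]

theorem IsDoubleStable.eq_listSeries {I : List ℤ} {G : MvPowerSeries (ℕ ⊕ ℕ) ℤ}
    (h : IsDoubleStable I G) : G = listSeries I := by
  induction h with
  | partition lam hlam p n w hw G hG => exact (isStableLimit_iff hlam hw G).1 hG
  | exchange I J p q hpq A B _ _ ihA ihB =>
    rw [Finset.sum_congr rfl ihA, Finset.sum_congr rfl ihB]
    have hlen : ∀ x y : ℤ, (I ++ [x, y] ++ J).length = I.length + 2 + J.length := by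
      intro x y; simp; omega
    have hs : (I ++ [p, q] ++ J).getD I.length 0 = p := by simp
    have ht : (I ++ [p, q] ++ J).getD (I.length + 1) 0 = q := by simp
    have h := resSeries_exchange (I.length + 2 + J.length) I.length (by omega)
      (fun j => (I ++ [p, q] ++ J).getD j 0) (by rw [hs, ht]; exact hpq)
    rw [hs, ht] at h
    simp only [← getD_append_pair I J p q] at h
    simp only [listSeries, hlen]
    exact h.symm
  | negative I p hp G _ ih =>
    rw [ih, listSeries, listSeries, List.length_append, List.length_append, List.length_singleton,
      List.length_singleton, resSeries_succ _ _ (by simp), resSeries_succ _ _ (by simp [hp.le])]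
    refine resSeries_congr _ fun j hj => ?_
    rw [List.getD_append _ _ _ _ hj, List.getD_append _ _ _ _ hj]
  | zero I G _ ih =>
    rw [ih, listSeries, listSeries, List.length_append, List.length_singleton,
      resSeries_succ _ _ (by simp)]
    refine resSeries_congr _ fun j hj => ?_
    rw [List.getD_append _ _ _ _ hj]

theorem IsPartition.antitone_getD {lam : List ℤ} (h : IsPartition lam) :
    Antitone fun j => lam.getD j 0 := by
  intro i j hij
  simp only
  rcases lt_or_ge j lam.length with hj | hj
  · rcases hij.eq_or_lt with rfl | e
    · exact le_rfl
    · rw [List.getD_eq_getElem _ _ hj, List.getD_eq_getElem _ _ (e.trans hj)]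
      exact List.pairwise_iff_getElem.1 h.1 i j _ hj e
  · rw [List.getD_eq_default _ _ hj]
    exact h.getD_nonneg i

/-- The first `p` values are prescribed and strictly increasing; the complement, in increasing
order, fills the other positions. The size `p + λ_1` is just enough. -/
theorem exists_isGrassmannian {lam : List ℤ} (h : IsPartition lam) :
    ∃ (p n : ℕ) (w : Equiv.Perm (Fin n)), IsGrassmannian lam p w := by
  set p := lam.length
  set q := (lam.getD 0 0).toNat
  have hbound : ∀ i : Fin p, ((i : ℕ) + lam.getD (p - 1 - i) 0).toNat < p + q := by
    intro i
    have h1 := h.antitone_getD (Nat.zero_le (p - 1 - i))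
    have h2 := h.getD_nonneg (p - 1 - i)
    simp only at h1
    omega
  set f : Fin p → Fin (p + q) := fun i => ⟨((i : ℕ) + lam.getD (p - 1 - i) 0).toNat, hbound i⟩
  have hf : StrictMono f := by
    intro i j hij
    have h1 := h.antitone_getD (show p - 1 - (j : ℕ) ≤ p - 1 - (i : ℕ) by
      have : (i : ℕ) < j := hij
      omega)
    have h2 := h.getD_nonneg (p - 1 - i)
    have h3 : (i : ℕ) < j := hij
    simp only at h1
    simp only [f, Fin.lt_def]
    omega
  set S : Finset (Fin (p + q)) := Finset.univ.map ⟨f, hf.injective⟩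
  have hS : S.card = p := by simp [S]
  have hSc : Sᶜ.card = q := by rw [Finset.card_compl, hS, Fintype.card_fin]; omega
  have hfS : f = S.orderEmbOfFin hS :=
    Finset.orderEmbOfFin_unique hS (fun i => by simp [S]) hf
  set w : Equiv.Perm (Fin (p + q)) := finSumFinEquiv.symm.trans (finSumEquivOfFinset hS hSc)
  have hw1 : ∀ i : Fin p, w (Fin.castAdd q i) = f i := fun i => by
    simp [w, hfS]
  have hw2 : ∀ i : Fin q, w (Fin.natAdd p i) = Sᶜ.orderEmbOfFin hSc i := fun i => by
    simp [w]
  refine ⟨p, p + q, w, Nat.le_add_right _ _, fun j hj => List.getD_eq_default _ _ hj,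
    fun i hi => ?_, fun i hi hip => ?_⟩
  · have := hw1 ⟨i, hi⟩
    have e : Fin.castAdd q ⟨i, hi⟩ = i := rfl
    rw [← e, this]
    have := h.getD_nonneg (p - 1 - i)
    simp only [f, e]
    omega
  · rcases lt_or_ge (i + 1) p with hlt | hge
    · have h1 := hw1 ⟨i, by omega⟩
      have h2 := hw1 ⟨i + 1, hlt⟩
      change w ⟨i, _⟩ = _ at h1
      change w ⟨i + 1, _⟩ = _ at h2
      rw [h1, h2]
      exact hf (Nat.lt_succ_self i)
    · obtain ⟨m, rfl⟩ : ∃ m, i = p + m := ⟨i - p, by omega⟩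
      have h1 := hw2 ⟨m, by omega⟩
      have h2 := hw2 ⟨m + 1, by omega⟩
      change w ⟨p + m, _⟩ = _ at h1
      change w ⟨p + m + 1, _⟩ = _ at h2
      rw [h1, h2]
      exact (Sᶜ.orderEmbOfFin hSc).strictMono (Nat.lt_succ_self m)

/-! ### Termination of straightening -/

section Straightening

/-- The number with the digits `x - L` in base `B`, after the number `a`. -/
def digitValue (L B a : ℤ) (I : List ℤ) : ℤ := I.foldl (fun a x => a * B + (x - L)) a

theorem digitValue_append (L B a : ℤ) (I J : List ℤ) :
    digitValue L B a (I ++ J) = digitValue L B (digitValue L B a I) J := List.foldl_append ..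

theorem digitValue_lt {L B : ℤ} (hB : 0 < B) (J : List ℤ) {a a' : ℤ} (h : a < a') :
    digitValue L B a J < digitValue L B a' J := by
  induction J generalizing a a' with
  | nil => exact h
  | cons x J ih =>
    refine ih ?_
    have := mul_lt_mul_of_pos_right h hB
    simp only
    omega

theorem digitValue_bound {L U : ℤ} (hLU : L ≤ U) (I : List ℤ) (hI : ∀ x ∈ I, L ≤ x ∧ x ≤ U)
    (a : ℤ) : digitValue L (U - L + 1) a I < (a + 1) * (U - L + 1) ^ I.length := by
  induction I generalizing a with
  | nil => simp [digitValue]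
  | cons x I ih =>
    have h1 := ih (fun y hy => hI y (List.mem_cons_of_mem _ hy)) (a * (U - L + 1) + (x - L))
    have h2 := hI x List.mem_cons_self
    refine lt_of_lt_of_le h1 ?_
    rw [List.length_cons, pow_succ', ← mul_assoc]
    refine mul_le_mul_of_nonneg_right ?_ (pow_nonneg (by omega) _)
    linarith

/-- Raising one digit outweighs any change in the next digit, since the digits involved lie between
`0` and `U - L`. -/
theorem digitValue_exchange_lt {L U : ℤ} (I J : List ℤ) {p q p' q' : ℤ} (hp : p < p')
    (hq : q ≤ U) (hq' : L ≤ q') (hLU : L ≤ U) :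
    digitValue L (U - L + 1) 0 (I ++ [p, q] ++ J) <
      digitValue L (U - L + 1) 0 (I ++ [p', q'] ++ J) := by
  rw [digitValue_append, digitValue_append, digitValue_append _ _ _ (I ++ [p', q']),
    digitValue_append _ _ _ I]
  refine digitValue_lt (by omega) J ?_
  simp only [digitValue, List.foldl_cons, List.foldl_nil]
  set a := List.foldl (fun a x => a * (U - L + 1) + (x - L)) 0 I
  have : (a * (U - L + 1) + (p - L) + 1) * (U - L + 1) ≤
      (a * (U - L + 1) + (p' - L)) * (U - L + 1) :=
    mul_le_mul_of_nonneg_right (by omega) (by omega)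
  linarith

theorem pairwise_or_exists_ascent (I : List ℤ) :
    I.Pairwise (fun a b => b ≤ a) ∨ ∃ X p q Y, I = X ++ [p, q] ++ Y ∧ p < q := by
  induction I with
  | nil => exact .inl .nil
  | cons x I ih =>
    rcases ih with h | ⟨X, p, q, Y, rfl, hpq⟩
    · cases I with
      | nil => exact .inl (List.pairwise_singleton _ _)
      | cons y I =>
        rcases lt_or_ge x y with hxy | hxy
        · exact .inr ⟨[], x, y, I, rfl, hxy⟩
        · refine .inl (List.pairwise_cons.2 ⟨fun z hz => ?_, h⟩)
          rcases List.mem_cons.1 hz with rfl | hz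
          · exact hxy
          · exact (List.rel_of_pairwise_cons h hz).trans hxy
    · exact .inr ⟨x :: X, p, q, Y, rfl, hpq⟩

/-- Read in base `U - L + 1`, the sequence becomes a bounded number that increases with each law: an
exchange replaces `p` by `q` or `q - 1`, both larger when they occur, and a negative last entry
becomes `0`. The entries stay in `[L, U]`, and a sequence to which neither law applies is a
partition. -/
theorem IsDoubleStable.exists_of_bounds {L U : ℤ} (hL : L ≤ 0) (hU : 0 ≤ U) (r : ℕ) (I : List ℤ)
    (hr : I.length = r) (hI : ∀ x ∈ I, L ≤ x ∧ x ≤ U) : ∃ G, IsDoubleStable I G := by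
  have hLU : L ≤ U := hL.trans hU
  induction hm : ((U - L + 1) ^ r - digitValue L (U - L + 1) 0 I).toNat
    using Nat.strong_induction_on generalizing I with
  | _ m ih =>
  have step : ∀ I' : List ℤ, I'.length = r → (∀ x ∈ I', L ≤ x ∧ x ≤ U) →
      digitValue L (U - L + 1) 0 I < digitValue L (U - L + 1) 0 I' →
      ∃ G, IsDoubleStable I' G := by
    intro I' hr' hI' hlt
    refine ih _ ?_ I' hr' hI' rfl
    have h1 := digitValue_bound hLU I' hI' 0
    rw [hr', zero_add, one_mul] at h1
    omega
  rcases pairwise_or_exists_ascent I with hpw | ⟨X, p, q, Y, rfl, hpq⟩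
  · rcases List.eq_nil_or_concat' I with rfl | ⟨X, p, rfl⟩
    · obtain ⟨p, n, w, hw⟩ := exists_isGrassmannian (lam := []) ⟨.nil, by simp⟩
      exact ⟨_, .partition [] ⟨.nil, by simp⟩ p n w hw _
        ((isStableLimit_iff ⟨.nil, by simp⟩ hw _).2 rfl)⟩
    rcases lt_or_ge p 0 with hp | hp
    · obtain ⟨G, hG⟩ := step (X ++ [0]) (by simpa using hr) (fun x hx => by
        rcases List.mem_append.1 hx with h | h
        · exact hI x (List.mem_append_left _ h)
        · rw [List.mem_singleton.1 h]; exact ⟨hL, hU⟩) (by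
        rw [digitValue_append, digitValue_append]
        simp only [digitValue, List.foldl_cons, List.foldl_nil]
        omega)
      exact ⟨G, .negative X p hp G hG⟩
    · have hpart : IsPartition (X ++ [p]) := ⟨hpw, fun x hx => by
        rcases List.mem_append.1 hx with h | h
        · exact hp.trans ((List.pairwise_append.1 hpw).2.2 x h p (List.mem_singleton_self p))
        · rw [List.mem_singleton.1 h]; exact hp⟩
      obtain ⟨p', n, w, hw⟩ := exists_isGrassmannian hpart
      exact ⟨_, .partition _ hpart p' n w hw _ ((isStableLimit_iff hpart hw _).2 rfl)⟩
  · have hp := hI p (by simp)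
    have hq := hI q (by simp)
    have hexch : ∀ p' k : ℤ, p < p' → p' ≤ q → p + 1 ≤ k → k ≤ q →
        ∃ G, IsDoubleStable (X ++ [p', k] ++ Y) G := by
      intro p' k h1 h2 h3 h4
      refine step _ (by simpa using hr) (fun x hx => ?_)
        (digitValue_exchange_lt X Y h1 hq.2 (by omega) hLU)
      simp only [List.mem_append, List.mem_cons, List.not_mem_nil, or_false] at hx
      rcases hx with (hx | rfl | rfl) | hx
      · exact hI x (by simp [hx])
      · omega
      · omega
      · exact hI x (by simp [hx])
    have hA : ∀ k, ∃ G, k ∈ Finset.Icc (p + 1) q → IsDoubleStable (X ++ [q, k] ++ Y) G := by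
      intro k
      by_cases hk : k ∈ Finset.Icc (p + 1) q
      · rw [Finset.mem_Icc] at hk
        obtain ⟨G, hG⟩ := hexch q k hpq le_rfl hk.1 hk.2
        exact ⟨G, fun _ => hG⟩
      · exact ⟨0, fun h => absurd h hk⟩
    have hB : ∀ k, ∃ G, k ∈ Finset.Icc (p + 1) (q - 1) →
        IsDoubleStable (X ++ [q - 1, k] ++ Y) G := by
      intro k
      by_cases hk : k ∈ Finset.Icc (p + 1) (q - 1)
      · rw [Finset.mem_Icc] at hk
        obtain ⟨G, hG⟩ := hexch (q - 1) k (by omega) (by omega) hk.1 (by omega)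
        exact ⟨G, fun _ => hG⟩
      · exact ⟨0, fun h => absurd h hk⟩
    choose A hA using hA
    choose B hB using hB
    exact ⟨_, .exchange X Y p q hpq A B hA hB⟩

theorem isDoubleStable_iff (I : List ℤ) (G : MvPowerSeries (ℕ ⊕ ℕ) ℤ) :
    IsDoubleStable I G ↔ G = listSeries I := by
  refine ⟨IsDoubleStable.eq_listSeries, ?_⟩
  rintro rfl
  set M : ℤ := (I.map fun x => |x|).sum
  have hM : ∀ x ∈ I, |x| ≤ M := fun x hx =>
    List.single_le_sum (by simp) _ (List.mem_map_of_mem hx)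
  have hM0 : 0 ≤ M := List.sum_nonneg (by simp)
  obtain ⟨G, hG⟩ := IsDoubleStable.exists_of_bounds (L := -M) (U := M) (by omega) hM0 _ I rfl
    fun x hx => abs_le.1 (hM x hx)
  rwa [← hG.eq_listSeries]

end Straightening

/-! ### Residues as limits of circle integrals -/

section Residues

/-- The normalized integrals of `f` over the circles around `0` converge to `v` as the radius
varies along `l`. -/
def HasCircleLimit (l : Filter ℝ) (f : ℂ → ℂ) (v : ℂ) : Prop :=
  (∀ᶠ R in l, CircleIntegrable f 0 R) ∧
    Tendsto (fun R : ℝ => (2 * (Real.pi : ℂ) * Complex.I)⁻¹ * ∮ z in C(0, R), f z) l (𝓝 v)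

/-- The filter `L` contains the circles around `0` with radius varying along `l`. -/
structure CircleFilter (l : Filter ℝ) (L : Filter ℂ) : Prop where
  pos : ∀ᶠ R in l, 0 < R
  eventually_sphere : ∀ p : ℂ → Prop, (∀ᶠ z in L, p z) → ∀ᶠ R in l, ∀ z : ℂ, ‖z‖ = R → p z
  eventually_ne : ∀ a : ℂ, ∀ᶠ z in L, z ≠ a

theorem circleFilter_zero : CircleFilter (𝓝[>] (0 : ℝ)) (𝓝[≠] (0 : ℂ)) where
  pos := self_mem_nhdsWithin
  eventually_sphere p hp := by
    rw [eventually_nhdsWithin_iff, Metric.eventually_nhds_iff] at hp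
    obtain ⟨ε, hε, h⟩ := hp
    filter_upwards [Ioo_mem_nhdsGT hε] with R hR z hz
    refine h (by rw [dist_zero_right, hz]; exact hR.2) ?_
    rw [Set.mem_compl_singleton_iff, ← norm_pos_iff, hz]
    exact hR.1
  eventually_ne a := by
    by_cases ha : a = 0
    · rw [ha]; exact self_mem_nhdsWithin
    · exact nhdsWithin_le_nhds (isOpen_ne.mem_nhds (Ne.symm ha))

theorem circleFilter_infty : CircleFilter (atTop : Filter ℝ) (Bornology.cobounded ℂ) where
  pos := eventually_gt_atTop 0
  eventually_sphere p hp := by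
    rw [← comap_norm_atTop, eventually_comap] at hp
    exact hp
  eventually_ne a := Bornology.eventually_ne_cobounded a

variable {l : Filter ℝ} {L : Filter ℂ}

theorem HasCircleLimit.const_mul {f : ℂ → ℂ} {v : ℂ} (h : HasCircleLimit l f v) (c : ℂ) :
    HasCircleLimit l (fun z => c * f z) (c * v) := by
  refine ⟨h.1.mono fun R hR => ?_, ?_⟩
  · exact hR.const_smul (a := c)
  · refine (h.2.const_mul c).congr fun R => ?_
    rw [circleIntegral.integral_const_mul]; ring

theorem HasCircleLimit.add {f g : ℂ → ℂ} {v w : ℂ} (hf : HasCircleLimit l f v)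
    (hg : HasCircleLimit l g w) : HasCircleLimit l (fun z => f z + g z) (v + w) := by
  refine ⟨(hf.1.and hg.1).mono fun R hR => hR.1.add hR.2, (hf.2.add hg.2).congr' ?_⟩
  filter_upwards [hf.1, hg.1] with R h1 h2
  rw [circleIntegral.integral_add h1 h2, mul_add]

theorem HasCircleLimit.zero : HasCircleLimit l (fun _ => 0) 0 :=
  ⟨Eventually.of_forall fun R => circleIntegrable_const 0 0 R, by
    simpa [circleIntegral] using tendsto_const_nhds⟩

theorem HasCircleLimit.sum {ι : Type*} (s : Finset ι) {f : ι → ℂ → ℂ} {v : ι → ℂ}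
    (h : ∀ i, HasCircleLimit l (f i) (v i)) :
    HasCircleLimit l (fun z => ∑ i ∈ s, f i z) (∑ i ∈ s, v i) := by
  classical
  induction s using Finset.induction_on with
  | empty => simpa using HasCircleLimit.zero
  | insert a s ha ih =>
    simp only [Finset.sum_insert ha]
    exact (h a).add ih

theorem HasCircleLimit.congr (H : CircleFilter l L) {f g : ℂ → ℂ} {v : ℂ}
    (hf : HasCircleLimit l f v) (hfg : ∀ᶠ z in L, f z = g z) : HasCircleLimit l g v := by
  have hS := (H.eventually_sphere _ hfg).and H.pos
  refine ⟨?_, hf.2.congr' ?_⟩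
  · filter_upwards [hf.1, hS] with R h1 h2
    refine (circleIntegrable_congr fun z hz => h2.1 z ?_).1 h1
    simpa [abs_of_pos h2.2] using hz
  · filter_upwards [hS] with R h2
    congr 1
    refine circleIntegral.integral_congr h2.2.le fun z hz => h2.1 z (by simpa using hz)

theorem hasCircleLimit_zpow (H : CircleFilter l L) (m : ℤ) :
    HasCircleLimit l (fun z => z ^ m) (if m = -1 then 1 else 0) := by
  refine ⟨H.pos.mono fun R hR => ?_, ?_⟩
  · refine ContinuousOn.circleIntegrable hR.le fun z hz => ?_
    refine (continuousAt_zpow₀ z m (.inl ?_)).continuousWithinAt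
    rintro rfl
    simp at hz; exact hR.ne hz
  · refine tendsto_const_nhds.congr' (H.pos.mono fun R hR => ?_)
    split_ifs with hm
    · subst hm
      have := circleIntegral.integral_sub_center_inv 0 hR.ne'
      simp only [sub_zero] at this
      simp only [zpow_neg_one, this]
      rw [inv_mul_cancel₀ Complex.two_pi_I_ne_zero]
    · have := circleIntegral.integral_sub_zpow_of_ne hm 0 0 R
      simp only [sub_zero] at this
      simp only [this, mul_zero]

/-- The length of the circle, proportional to `R`, is beaten by a bound `o(1 / R)` on the integrand.
-/
theorem hasCircleLimit_zero_of_isLittleO (H : CircleFilter l L) {f : ℂ → ℂ}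
    (hint : ∀ᶠ R in l, CircleIntegrable f 0 R) (hf : f =o[L] fun z => z⁻¹) :
    HasCircleLimit l f 0 := by
  refine ⟨hint, ?_⟩
  rw [Metric.tendsto_nhds]
  intro ε hε
  have h1 := hf.def (half_pos hε)
  filter_upwards [H.eventually_sphere _ h1, H.pos] with R h2 hR
  rw [dist_zero_right]
  have h3 := circleIntegral.norm_two_pi_i_inv_smul_integral_le_of_norm_le_const (f := f) (c := 0)
    (C := ε / 2 * R⁻¹) hR.le fun z hz => by
      have hz' : ‖z‖ = R := by simpa using hz
      have := h2 z hz'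
      rwa [norm_inv, hz'] at this
  rw [mul_comm R, inv_mul_cancel_right₀ hR.ne', smul_eq_mul] at h3
  exact lt_of_le_of_lt h3 (half_lt_self hε)

/-- The power series `p` is the asymptotic expansion of `g` at `0`. -/
def HasExpansion (g : ℂ → ℂ) (p : PowerSeries ℂ) : Prop :=
  ∀ m : ℕ, ∃ q : Polynomial ℂ, (∀ i < m, q.coeff i = PowerSeries.coeff i p) ∧
    (fun w => g w - q.eval w) =O[𝓝[≠] 0] fun w => w ^ m

theorem isBigO_eval_one (q : Polynomial ℂ) :
    (fun w => q.eval w) =O[𝓝[≠] 0] fun _ => (1 : ℂ) :=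
  (q.continuous.continuousAt.tendsto.mono_left nhdsWithin_le_nhds).isBigO_one ℂ

theorem HasExpansion.isBigO_one {g : ℂ → ℂ} {p : PowerSeries ℂ} (h : HasExpansion g p) :
    g =O[𝓝[≠] 0] fun _ => (1 : ℂ) := by
  obtain ⟨q, -, hq⟩ := h 0
  simp only [pow_zero] at hq
  simpa using hq.add (isBigO_eval_one q)

theorem HasExpansion.mul {g g' : ℂ → ℂ} {p p' : PowerSeries ℂ} (h : HasExpansion g p)
    (h' : HasExpansion g' p') : HasExpansion (fun w => g w * g' w) (p * p') := by
  intro m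
  obtain ⟨q, hq, hO⟩ := h m
  obtain ⟨q', hq', hO'⟩ := h' m
  refine ⟨q * q', fun i hi => ?_, ?_⟩
  · rw [Polynomial.coeff_mul, PowerSeries.coeff_mul]
    refine Finset.sum_congr rfl fun x hx => ?_
    rw [Finset.HasAntidiagonal.mem_antidiagonal] at hx
    rw [hq _ (by omega), hq' _ (by omega)]
  · have h1 := hO.mul h'.isBigO_one
    have h2 := (isBigO_eval_one q).mul hO'
    simp only [mul_one, one_mul] at h1 h2
    refine (h1.add h2).congr_left fun w => ?_
    rw [Polynomial.eval_mul]; ring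

theorem HasExpansion.congr {g g' : ℂ → ℂ} {p : PowerSeries ℂ} (h : HasExpansion g p)
    (hg : ∀ᶠ w in 𝓝[≠] 0, g w = g' w) : HasExpansion g' p := by
  intro m
  obtain ⟨q, hq, hO⟩ := h m
  exact ⟨q, hq, hO.congr' (hg.mono fun w hw => by simp only [hw]) .rfl⟩

theorem hasExpansion_eval (q : Polynomial ℂ) :
    HasExpansion (fun w => q.eval w) (q : PowerSeries ℂ) := fun m =>
  ⟨q, fun i _ => (Polynomial.coeff_coe q i).symm, by
    simpa using Asymptotics.isBigO_zero (fun w : ℂ => w ^ m) (𝓝[≠] 0)⟩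

theorem hasExpansion_one : HasExpansion (fun _ => 1) 1 := by
  simpa using hasExpansion_eval 1

theorem eventually_one_sub_mul_ne_zero (α : ℂ) : ∀ᶠ w : ℂ in 𝓝[≠] 0, 1 - α * w ≠ 0 := by
  have h : ContinuousAt (fun w : ℂ => 1 - α * w) 0 := by fun_prop
  exact nhdsWithin_le_nhds (h.eventually_ne (by simp))

theorem hasExpansion_inv (α : ℂ) : HasExpansion (fun w => (1 - α * w)⁻¹) (geomSeries α) := by
  intro m
  refine ⟨∑ i ∈ Finset.range m, Polynomial.monomial i (α ^ i), fun i hi => ?_, ?_⟩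
  · simp [Polynomial.coeff_monomial, geomSeries, hi]
  · have h1 : (fun w : ℂ => α ^ m * (1 - α * w)⁻¹) =O[𝓝[≠] 0] fun _ => (1 : ℂ) := by
      have : ContinuousAt (fun w : ℂ => α ^ m * (1 - α * w)⁻¹) 0 := by
        refine continuousAt_const.mul (ContinuousAt.inv₀ (by fun_prop) (by simp))
      exact (this.tendsto.mono_left nhdsWithin_le_nhds).isBigO_one ℂ
    have h2 := (Asymptotics.isBigO_refl (fun w : ℂ => w ^ m) (𝓝[≠] 0)).mul h1
    simp only [mul_one] at h2
    refine h2.congr' ?_ .rfl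
    filter_upwards [eventually_one_sub_mul_ne_zero α] with w hw
    have h3 : ∑ i ∈ Finset.range m, (α * w) ^ i * (1 - α * w) = 1 - (α * w) ^ m := by
      rw [← Finset.sum_mul]
      exact geom_sum_mul_neg _ _
    rw [Polynomial.eval_finsetSum, eq_sub_iff_add_eq, ← mul_left_inj' hw, inv_mul_cancel₀ hw,
      add_mul, Finset.sum_mul]
    simp only [Polynomial.eval_monomial, ← mul_pow]
    rw [h3]
    field_simp
    ring

theorem HasExpansion.prod {ι : Type*} (s : Finset ι) {g : ι → ℂ → ℂ} {p : ι → PowerSeries ℂ}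
    (h : ∀ i, HasExpansion (g i) (p i)) :
    HasExpansion (fun w => ∏ i ∈ s, g i w) (∏ i ∈ s, p i) := by
  classical
  induction s using Finset.induction_on with
  | empty => simpa using hasExpansion_one
  | insert a s ha ih =>
    simp only [Finset.prod_insert ha]
    exact (h a).mul ih

theorem hasExpansion_one_sub_zpow (n : ℤ) :
    HasExpansion (fun w => (1 - w) ^ n) (oneSubPow n) := by
  have hne : ∀ᶠ w : ℂ in 𝓝[≠] 0, 1 - w ≠ 0 := by
    simpa using eventually_one_sub_mul_ne_zero 1
  induction n using Int.induction_on with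
  | zero => simpa using hasExpansion_one
  | succ n ih =>
    rw [oneSubPow_add_one]
    have h1 : HasExpansion (fun w => 1 - w) (1 - PowerSeries.X) := by
      have := hasExpansion_eval (1 - Polynomial.X)
      rw [Polynomial.coe_sub, Polynomial.coe_one, Polynomial.coe_X] at this
      simpa using this
    refine (h1.mul ih).congr (hne.mono fun w hw => ?_)
    rw [zpow_add_one₀ hw, mul_comm]
  | pred n ih =>
    have h1 := oneSubPow_add_one_mul_geomSeries_one (R := ℂ) (-n - 1)
    rw [sub_add_cancel] at h1
    rw [← h1]
    refine (ih.mul (hasExpansion_inv 1)).congr (hne.mono fun w hw => ?_)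
    rw [zpow_sub_one₀ hw, one_mul]

/-- The exponent `s` is `1` for the residue at `0` and `-1` for the one at `∞`. The polynomial part
integrates termwise, where only `z⁻¹` survives, and the remainder is `o(z⁻¹)`. An asymptotic
expansion thus suffices, without convergence of the series. -/
theorem hasCircleLimit_of_hasExpansion (H : CircleFilter l L) {s : ℤ} (hs : s = 1 ∨ s = -1)
    (hL : Tendsto (fun z : ℂ => z ^ s) L (𝓝[≠] 0)) {g : ℂ → ℂ} {p : PowerSeries ℂ}
    (hg : HasExpansion g p) (c : ℤ) {f : ℂ → ℂ}
    (hf : ∀ᶠ z in L, f z = z⁻¹ * ((z ^ s) ^ c * g (z ^ s)))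
    (hint : ∀ᶠ R in l, CircleIntegrable f 0 R) :
    HasCircleLimit l f (intCoeff p (-c)) := by
  -- This order ensures `-c < m`, so that the wanted coefficient is among those known, and `c + m >
  -- 0`, so that the remainder is small.
  obtain ⟨q, hq, hO⟩ := hg ((1 - c).toNat + 1)
  set m := (1 - c).toNat + 1
  set S : ℂ → ℂ := fun z => ∑ i ∈ Finset.range (q.natDegree + 1),
    q.coeff i * z ^ (-1 + s * (c + i)) with hS
  have hSlim : HasCircleLimit l S (intCoeff p (-c)) := by
    have h1 : HasCircleLimit l S (∑ i ∈ Finset.range (q.natDegree + 1),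
        q.coeff i * if -1 + s * (c + i) = -1 then 1 else 0) :=
      HasCircleLimit.sum _ fun i => (hasCircleLimit_zpow H _).const_mul _
    convert h1 using 1
    have h2 : ∀ i : ℕ, (-1 + s * (c + i) = -1) ↔ (i : ℤ) = -c := by
      intro i; rcases hs with rfl | rfl <;> omega
    simp only [h2]
    rcases lt_or_ge (-c) 0 with hc | hc
    · rw [intCoeff_of_neg _ hc]
      refine (Finset.sum_eq_zero fun i _ => ?_).symm
      rw [if_neg (by omega), mul_zero]
    · obtain ⟨N, hN⟩ : ∃ N : ℕ, -c = N := ⟨(-c).toNat, by omega⟩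
      rw [hN, intCoeff_natCast, ← hq N (by omega)]
      simp only [Nat.cast_inj, mul_ite, mul_one, mul_zero, Finset.sum_ite_eq', Finset.mem_range]
      split_ifs with h3
      · rfl
      · exact Polynomial.coeff_eq_zero_of_natDegree_lt (by omega)
  have hrem : (fun z => f z - S z) =o[L] fun z => z⁻¹ := by
    have h1 : (fun z => z⁻¹ * ((z ^ s) ^ c * (g (z ^ s) - q.eval (z ^ s)))) =O[L]
        fun z => z⁻¹ * ((z ^ s) ^ c * (z ^ s) ^ m) :=
      (Asymptotics.isBigO_refl _ _).mul ((Asymptotics.isBigO_refl _ _).mul (hO.comp_tendsto hL))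
    have h2 : (fun z : ℂ => z⁻¹ * ((z ^ s) ^ c * (z ^ s) ^ m)) =o[L] fun z => z⁻¹ * 1 := by
      refine (Asymptotics.isBigO_refl _ _).mul_isLittleO ?_
      rw [Asymptotics.isLittleO_one_iff]
      have h3 : Tendsto (fun w : ℂ => w ^ (c + m).toNat) (𝓝[≠] 0) (𝓝 0) := by
        have : ContinuousAt (fun w : ℂ => w ^ (c + m).toNat) 0 := by fun_prop
        have h4 := this.tendsto.mono_left (nhdsWithin_le_nhds (s := {0}ᶜ))
        rwa [zero_pow (by omega)] at h4
      refine (h3.comp hL).congr' ?_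
      filter_upwards [H.eventually_ne 0] with z hz
      rw [Function.comp_apply, ← zpow_natCast, ← zpow_natCast, ← zpow_add₀ (zpow_ne_zero s hz)]
      congr 1; omega
    simp only [mul_one] at h2
    refine (h1.trans_isLittleO h2).congr' ?_ .rfl
    filter_upwards [hf, H.eventually_ne 0] with z hz hz0
    rw [hz, mul_sub, mul_sub, Polynomial.eval_eq_sum_range, hS]
    congr 1
    rw [Finset.mul_sum, Finset.mul_sum]
    refine Finset.sum_congr rfl fun i _ => ?_
    rw [zpow_add₀ hz0, zpow_neg_one, zpow_mul, zpow_add₀ (zpow_ne_zero s hz0), zpow_natCast]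
    ring
  have hint' : ∀ᶠ R in l, CircleIntegrable (fun z => f z - S z) 0 R := by
    filter_upwards [hint, hSlim.1] with R h1 h2
    exact h1.sub h2
  have := (hasCircleLimit_zero_of_isLittleO H hint' hrem).add hSlim
  simpa using this

end Residues

/-! ### The one-variable integrand near `0` and `∞` -/

section Integrand

variable {k l : ℕ} (α : Fin k → ℂ) (β : Fin l → ℂ)

/-- The factor of the integrand that belongs to one variable. -/
def integrandFactor (a b : ℤ) (z : ℂ) : ℂ :=
  (1 - z) ^ a * ((∏ i, (1 - z * β i)) / ((∏ i, (1 - z * α i)) * (1 - z) ^ ((l : ℤ) - (k : ℤ)))) *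
    z⁻¹ * z ^ b

variable {α β}

theorem one_sub_mul_ne_zero {a z : ℂ} (hz : z ≠ a⁻¹) : 1 - z * a ≠ 0 := by
  intro h
  exact hz (eq_inv_of_mul_eq_one_left (sub_eq_zero.1 h).symm)

theorem circleIntegrable_integrandFactor {r : Filter ℝ} {L : Filter ℂ}
    (H : CircleFilter r L) (a b : ℤ) :
    ∀ᶠ R in r, CircleIntegrable (integrandFactor α β a b) 0 R := by
  have h1 : ∀ᶠ z in L, ∀ i, z ≠ (α i)⁻¹ := eventually_all.2 fun i => H.eventually_ne _
  filter_upwards [H.eventually_sphere _ ((h1.and (H.eventually_ne 0)).and (H.eventually_ne 1)),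
    H.pos] with R h2 hR
  refine ContinuousOn.circleIntegrable hR.le fun z hz => ContinuousAt.continuousWithinAt ?_
  obtain ⟨⟨h3, h4⟩, h5⟩ := h2 z (by simpa using hz)
  have h6 : 1 - z ≠ 0 := sub_ne_zero.2 (Ne.symm h5)
  have hc : ∀ n : ℤ, ContinuousAt (fun z : ℂ => (1 - z) ^ n) z := fun n =>
    (continuousAt_const.sub continuousAt_id).zpow₀ n (.inl h6)
  refine (((hc a).mul (ContinuousAt.div₀ ?_ (ContinuousAt.mul ?_ (hc _)) ?_)).mul
    (continuousAt_id.inv₀ h4)).mul (continuousAt_id.zpow₀ b (.inl h4))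
  · fun_prop
  · fun_prop
  · exact mul_ne_zero (Finset.prod_ne_zero_iff.2 fun i _ => one_sub_mul_ne_zero (h3 i))
      (zpow_ne_zero _ h6)

theorem hasCircleLimit_integrandFactor_zero (a b : ℤ) :
    HasCircleLimit (𝓝[>] 0) (integrandFactor α β a b)
      (intCoeff (seriesZero k l (a + k - l) (extendOne α) (extendOne β)) (-b)) := by
  have hg : HasExpansion (fun w => ((1 - w) ^ (a + k - l) *
      ∏ q ∈ Finset.range l, (1 - extendOne β q * w)) *
        ∏ s ∈ Finset.range k, (1 - extendOne α s * w)⁻¹)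
      (seriesZero k l (a + k - l) (extendOne α) (extendOne β)) := by
    refine ((hasExpansion_one_sub_zpow _).mul (HasExpansion.prod _ fun q => ?_)).mul
      (HasExpansion.prod _ fun s => hasExpansion_inv _)
    have := hasExpansion_eval (1 - Polynomial.C (extendOne β q) * Polynomial.X)
    rw [Polynomial.coe_sub, Polynomial.coe_one, Polynomial.coe_mul, Polynomial.coe_C,
      Polynomial.coe_X] at this
    simpa using this
  refine hasCircleLimit_of_hasExpansion circleFilter_zero (.inl rfl) ?_ hg b ?_
    (circleIntegrable_integrandFactor circleFilter_zero a b)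
  · simp only [zpow_one]
    exact tendsto_id
  · filter_upwards [circleFilter_zero.eventually_ne 1] with z hz
    have h6 : 1 - z ≠ 0 := sub_ne_zero.2 (Ne.symm hz)
    rw [integrandFactor, zpow_one, ← Fin.prod_univ_eq_prod_range (fun q => 1 - extendOne β q * z),
      ← Fin.prod_univ_eq_prod_range (fun s => (1 - extendOne α s * z)⁻¹), Finset.prod_inv_distrib,
      show a + k - (l : ℤ) = a - ((l : ℤ) - k) by ring, zpow_sub₀ h6 a]
    simp only [extendOne_val, mul_comm z]
    generalize (1 - z) ^ ((l : ℤ) - k) = X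
    rw [div_eq_mul_inv, div_eq_mul_inv, mul_inv]
    ring

/-- In terms of `w = 1 / z`: `1 - z = -z (1 - w)`, `1 - β z = z (w - β)` and `(1 - α z)⁻¹ = -(w / α)
(1 - w / α)⁻¹`. These account for the sign, the constant `∏ α_s⁻¹` and the power of `w`. -/
theorem hasCircleLimit_integrandFactor_infty (hα : ∀ i, α i ≠ 0) (a b : ℤ) :
    HasCircleLimit atTop (integrandFactor α β a b)
      ((-1) ^ (a + k - l + k) * (∏ s ∈ Finset.range k, (extendOne α s)⁻¹) *
        intCoeff (seriesInfty k l (a + k - l) (fun s => (extendOne α s)⁻¹) (extendOne β))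
          (a + k - l - k + l + b)) := by
  have hg : HasExpansion (fun w => ((1 - w) ^ (a + k - l) *
      ∏ q ∈ Finset.range l, (w - extendOne β q)) *
        ∏ s ∈ Finset.range k, (1 - (extendOne α s)⁻¹ * w)⁻¹)
      (seriesInfty k l (a + k - l) (fun s => (extendOne α s)⁻¹) (extendOne β)) := by
    refine ((hasExpansion_one_sub_zpow _).mul (HasExpansion.prod _ fun q => ?_)).mul
      (HasExpansion.prod _ fun s => hasExpansion_inv _)
    have := hasExpansion_eval (Polynomial.X - Polynomial.C (extendOne β q))
    rw [Polynomial.coe_sub, Polynomial.coe_C, Polynomial.coe_X] at this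
    simpa using this
  set C : ℂ := (-1) ^ (a + k - l + k) * ∏ s ∈ Finset.range k, (extendOne α s)⁻¹ with hC
  have h0 : C ≠ 0 := mul_ne_zero (zpow_ne_zero _ (by norm_num))
    (Finset.prod_ne_zero_iff.2 fun s _ => inv_ne_zero (extendOne_ne_zero hα s))
  have hlim := hasCircleLimit_of_hasExpansion (f := fun z => C⁻¹ * integrandFactor α β a b z)
    circleFilter_infty (.inr rfl) ?_ hg
    (-(a + k - l - k + l + b)) ?_ ?_
  · rw [neg_neg] at hlim
    refine (hlim.const_mul C).congr circleFilter_infty (Eventually.of_forall fun z => ?_)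
    rw [mul_inv_cancel_left₀ h0]
  · simp only [zpow_neg_one]
    exact tendsto_inv₀_cobounded'
  · have h1 : ∀ᶠ z in Bornology.cobounded ℂ, ∀ i, z ≠ (α i)⁻¹ :=
      eventually_all.2 fun i => circleFilter_infty.eventually_ne _
    filter_upwards [circleFilter_infty.eventually_ne 1, circleFilter_infty.eventually_ne 0, h1]
      with z hz1 hz0 hzα
    have h6 : 1 - z ≠ 0 := sub_ne_zero.2 (Ne.symm hz1)
    have h7 : 1 - z⁻¹ = -1 * (1 - z) * z⁻¹ := by field_simp; ring
    have hβ : ∏ q ∈ Finset.range l, (z⁻¹ - extendOne β q) = z⁻¹ ^ l * ∏ i, (1 - z * β i) := by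
      rw [← Fin.prod_univ_eq_prod_range (fun q => z⁻¹ - extendOne β q)]
      have : ∀ i : Fin l, z⁻¹ - extendOne β i = z⁻¹ * (1 - z * β i) := fun i => by
        rw [extendOne_val]; field_simp
      simp only [this, Finset.prod_mul_distrib, Finset.prod_const, Finset.card_univ,
        Fintype.card_fin]
    have hα' : ∏ s ∈ Finset.range k, (1 - (extendOne α s)⁻¹ * z⁻¹)⁻¹ =
        (-1) ^ k * z ^ k * (∏ s ∈ Finset.range k, extendOne α s) * (∏ i, (1 - z * α i))⁻¹ := by
      rw [← Fin.prod_univ_eq_prod_range (fun s => (1 - (extendOne α s)⁻¹ * z⁻¹)⁻¹),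
        ← Fin.prod_univ_eq_prod_range (fun s => extendOne α s)]
      have : ∀ i : Fin k, (1 - (extendOne α i)⁻¹ * z⁻¹)⁻¹ =
          (-1) * z * extendOne α i * (1 - z * α i)⁻¹ := fun i => by
        have h8 := one_sub_mul_ne_zero (hzα i)
        have h9 := hα i
        rw [extendOne_val, inv_eq_iff_eq_inv, mul_inv, inv_inv]
        field_simp
        ring
      simp only [this, Finset.prod_mul_distrib, Finset.prod_const, Finset.card_univ,
        Fintype.card_fin, Finset.prod_inv_distrib]
    rw [zpow_neg_one, hβ, hα', h7, mul_zpow, mul_zpow, hC, mul_inv, Finset.prod_inv_distrib, inv_inv,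
      integrandFactor]
    have e1 : ((-1 : ℂ) ^ (a + k - l + k))⁻¹ = (-1) ^ (a + k - (l : ℤ)) * (-1) ^ k := by
      rw [zpow_add₀ (by norm_num), mul_inv, ← zpow_neg, zpow_natCast, ← inv_pow, inv_neg_one]
      congr 1
      rw [zpow_neg, ← inv_zpow, inv_neg_one]
    have e2 : (1 - z) ^ (a + k - (l : ℤ)) = (1 - z) ^ a * ((1 - z) ^ ((l : ℤ) - k))⁻¹ := by
      rw [show a + k - (l : ℤ) = a - ((l : ℤ) - k) by ring, zpow_sub₀ h6, div_eq_mul_inv]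
    have e3 : z⁻¹ ^ (-(a + k - (l : ℤ) - k + l + b)) * (z⁻¹ ^ (a + k - (l : ℤ)) * z⁻¹ ^ l * z ^ k) =
        z ^ b := by
      rw [← zpow_natCast, ← zpow_natCast, inv_zpow', inv_zpow', inv_zpow', ← zpow_add₀ hz0,
        ← zpow_add₀ hz0, ← zpow_add₀ hz0]
      congr 1; ring
    rw [e1, e2, ← e3, div_eq_mul_inv, mul_inv]
    ring
  · filter_upwards [circleIntegrable_integrandFactor circleFilter_infty a b] with R hR
    exact hR.const_smul (a := C⁻¹)

end Integrand

/-! ### The iterated residue as a determinant -/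

section IteratedResidue

/-- The sum of the residues at `0` and `∞` exists and is equal to `v`. -/
def HasResZeroInfty (f : ℂ → ℂ) (v : ℂ) : Prop :=
  ∃ v₀ v₁, HasCircleLimit (𝓝[>] 0) f v₀ ∧ HasCircleLimit atTop f v₁ ∧ v = v₀ - v₁

theorem HasResZeroInfty.eq {f : ℂ → ℂ} {v : ℂ} (h : HasResZeroInfty f v) :
    resZeroInfty f = v := by
  obtain ⟨v₀, v₁, h₀, h₁, rfl⟩ := h
  rw [resZeroInfty, resZero, resInfty, h₀.2.limUnder_eq, h₁.2.limUnder_eq, sub_eq_add_neg]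

theorem HasResZeroInfty.sum_const_mul {ι : Type*} (s : Finset ι) {f : ι → ℂ → ℂ} {v c : ι → ℂ}
    (h : ∀ i, HasResZeroInfty (f i) (v i)) :
    HasResZeroInfty (fun z => ∑ i ∈ s, c i * f i z) (∑ i ∈ s, c i * v i) := by
  choose v₀ v₁ h₀ h₁ hv using h
  refine ⟨_, _, HasCircleLimit.sum s fun i => (h₀ i).const_mul (c i),
    HasCircleLimit.sum s fun i => (h₁ i).const_mul (c i), ?_⟩
  rw [← Finset.sum_sub_distrib]
  exact Finset.sum_congr rfl fun i _ => by rw [hv, mul_sub]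

theorem HasResZeroInfty.congr {f g : ℂ → ℂ} {v : ℂ} (h : HasResZeroInfty f v)
    (hfg : ∀ z, z ≠ 0 → f z = g z) : HasResZeroInfty g v := by
  obtain ⟨v₀, v₁, h₀, h₁, hv⟩ := h
  exact ⟨v₀, v₁, h₀.congr circleFilter_zero ((circleFilter_zero.eventually_ne 0).mono hfg),
    h₁.congr circleFilter_infty ((circleFilter_infty.eventually_ne 0).mono hfg), hv⟩

/-- After the inner residues are taken, the factor in the outer variable is absorbed into the
coefficients `c`. Agreement away from the coordinate hyperplanes is enough, since the circles avoid
`0`. -/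
theorem iteratedRes_sum_prod {ι : Type*} (s : Finset ι) (r : ℕ) (c : ι → ℂ)
    (f : ι → Fin r → ℂ → ℂ) (v : ι → Fin r → ℂ) (h : ∀ i j, HasResZeroInfty (f i j) (v i j))
    (F : (Fin r → ℂ) → ℂ)
    (hF : ∀ z, (∀ j, z j ≠ 0) → F z = ∑ i ∈ s, c i * ∏ j, f i j (z j)) :
    iteratedRes r F = ∑ i ∈ s, c i * ∏ j, v i j := by
  induction r generalizing c with
  | zero => simpa [iteratedRes] using hF Fin.elim0 (fun j => j.elim0)
  | succ r ih =>
    have h1 := HasResZeroInfty.sum_const_mul s (c := fun i => c i * ∏ j : Fin r, v i j.succ)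
      fun i => h i 0
    have h2 : ∀ z : ℂ, z ≠ 0 → ∑ i ∈ s, (c i * ∏ j : Fin r, v i j.succ) * f i 0 z =
        iteratedRes r fun v => F (Fin.cons z v) := by
      intro z hz
      rw [ih (fun i => c i * f i 0 z) (fun i j => f i j.succ) (fun i j => v i j.succ)
        (fun i j => h i j.succ)]
      · exact Finset.sum_congr rfl fun i _ => by ring
      · intro y hy
        rw [hF _ (Fin.cases (by simpa using hz) (by simpa using hy))]
        refine Finset.sum_congr rfl fun i _ => ?_
        rw [Fin.prod_univ_succ, Fin.cons_zero]
        simp only [Fin.cons_succ]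
        ring
    rw [iteratedRes, (h1.congr h2).eq]
    refine Finset.sum_congr rfl fun i _ => ?_
    rw [Fin.prod_univ_succ]; ring

theorem hasResZeroInfty_integrandFactor {k l : ℕ} {α : Fin k → ℂ} {β : Fin l → ℂ}
    (hα : ∀ i, α i ≠ 0) (a b : ℤ) :
    HasResZeroInfty (integrandFactor α β a b)
      (resCoeff k l (extendOne α) (extendOne β) a b) :=
  ⟨_, _, hasCircleLimit_integrandFactor_zero a b, hasCircleLimit_integrandFactor_infty hα a b,
    rfl⟩

/-- Pulling out `z_i` from each factor leaves the Vandermonde product in the inverses `z_i⁻¹`. -/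
theorem prod_one_sub_div_eq_sum {r : ℕ} (z : Fin r → ℂ) (hz : ∀ j, z j ≠ 0) :
    ∏ j, ∏ i ∈ Finset.Ioi j, (1 - z i / z j) =
      ∑ σ : Equiv.Perm (Fin r), ((Equiv.Perm.sign σ : ℤ) : ℂ) *
        ∏ j, z j ^ (((j : ℕ) : ℤ) - (σ j : ℕ)) := by
  have h1 : ∏ j, ∏ i ∈ Finset.Ioi j, (1 - z i / z j) =
      (∏ i, z i ^ (i : ℕ)) * ∏ j, ∏ i ∈ Finset.Ioi j, ((z i)⁻¹ - (z j)⁻¹) := by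
    have h2 : ∏ i, z i ^ (i : ℕ) = ∏ j, ∏ i ∈ Finset.Ioi j, z i := by
      rw [Finset.prod_comm' (t' := Finset.univ) (s' := fun i => Finset.Iio i) (by simp)]
      exact Finset.prod_congr rfl fun i _ => by rw [Finset.prod_const, Fin.card_Iio]
    rw [h2, ← Finset.prod_mul_distrib]
    refine Finset.prod_congr rfl fun j _ => ?_
    rw [← Finset.prod_mul_distrib]
    refine Finset.prod_congr rfl fun i _ => ?_
    rw [mul_sub, mul_inv_cancel₀ (hz i), div_eq_mul_inv]
  rw [h1, ← Matrix.det_vandermonde (fun i => (z i)⁻¹), ← Matrix.det_transpose,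
    Matrix.det_apply', Finset.mul_sum]
  refine Finset.sum_congr rfl fun σ _ => ?_
  rw [mul_left_comm, ← Finset.prod_mul_distrib]
  congr 1
  refine Finset.prod_congr rfl fun j _ => ?_
  rw [Matrix.transpose_apply, Matrix.vandermonde_apply, zpow_sub₀ (hz j), zpow_natCast,
    zpow_natCast, inv_pow, div_eq_mul_inv]

/-- In the term of `σ` the variable `z_j` carries the exponent `j - σ j`, so the residues produce
the entry in row `σ j` and column `j`, and the signed sum is the Leibniz formula. -/
theorem gRes_eq_resDet (I : List ℤ) {k l : ℕ} (α : Fin k → ℂ) (β : Fin l → ℂ)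
    (hα : ∀ i, α i ≠ 0) :
    gRes I α β = resDet k (fun _ => l) (extendOne α) (extendOne β) I.length
      (fun j => I.getD j 0) := by
  rw [gRes, iteratedRes_sum_prod Finset.univ I.length
    (fun σ : Equiv.Perm (Fin I.length) => ((Equiv.Perm.sign σ : ℤ) : ℂ))
    (fun σ j => integrandFactor α β (I.get j - ((j : ℕ) + 1 : ℤ)) (((j : ℕ) : ℤ) - (σ j : ℕ)))
    (fun σ j => resCoeff k l (extendOne α) (extendOne β) (I.get j - ((j : ℕ) + 1 : ℤ))
      (((j : ℕ) : ℤ) - (σ j : ℕ)))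
    (fun σ j => hasResZeroInfty_integrandFactor hα _ _)]
  · rw [resDet, shiftDet, Matrix.det_apply']
    refine Finset.sum_congr rfl fun σ _ => ?_
    congr 1
    refine Finset.prod_congr rfl fun j _ => ?_
    rw [Matrix.of_apply, List.getD_eq_getElem _ _ j.2, List.get_eq_getElem]
  · intro z hz
    rw [prod_one_sub_div_eq_sum z hz, formM, Finset.mul_sum, Finset.sum_mul]
    refine Finset.sum_congr rfl fun σ _ => ?_
    simp only [integrandFactor, Finset.prod_mul_distrib]
    ring

end IteratedResidue

end StableGrothendieck

end

/-- For every integer sequence `I` the double stable Grothendieck polynomial `G_I` is well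
defined, as a power series in the `x_i = 1 - 1 / α_i`, `y_j = 1 - β_j`; and for all `k`, `l`, its
truncation to `α_1, …, α_k; β_1, …, β_l` is a polynomial in the `x_i`, `y_j`, whose value is
`g_I(α; β)` at all complex arguments with nonzero `α_i`. -/
theorem mainTheorem1 (I : List ℤ) :
    ∃ G : MvPowerSeries (ℕ ⊕ ℕ) ℤ,
      (∀ G' : MvPowerSeries (ℕ ⊕ ℕ) ℤ, StableGrothendieck.IsDoubleStable I G' ↔ G' = G) ∧
      ∀ k l : ℕ, ∃ P : MvPolynomial (Fin k ⊕ Fin l) ℤ,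
        (P : MvPowerSeries (Fin k ⊕ Fin l) ℤ) = StableGrothendieck.truncate k l G ∧
        ∀ (α : Fin k → ℂ) (β : Fin l → ℂ), (∀ i, α i ≠ 0) →
          MvPolynomial.aeval (Sum.elim (fun i => 1 - (α i)⁻¹) (fun j => 1 - β j)) P =
            StableGrothendieck.gRes I α β := by
  refine ⟨StableGrothendieck.listSeries I, StableGrothendieck.isDoubleStable_iff I,
    fun k l => ⟨_, StableGrothendieck.truncate_resSeries k l _ _, fun α β hα => ?_⟩⟩
  rw [StableGrothendieck.gRes_eq_resDet I α β hα]
  exact StableGrothendieck.aeval_killCompl_resPoly α β hα k _ _ _ le_rfl fun _ _ => le_rfl
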